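/- **Theorem (Certificate of multi-step descent).** Let $\rho = 1+\sqrt2$, let $\nu$ be the 2-adic valuation, and let $\alpha_t = \rho^{\nu(t+1)-1}+1$ ($t = 0,1,\dots$) be the silver stepsizes. For an integer $k \ge 1$ put $n = 2^k-1$ and $\pi^{(k)} = [\alpha_0,\dots,\alpha_{n-1}]$ (entries $\pi^{(k)}_1,\dots,\pi^{(k)}_n$), and define recursively $c^{(1)} = [2(\rho-1)]$ and $$c^{(k+1)} = \big[\pi^{(k)},\ (1+\rho^{-k})(\rho^{k-1}+1),\ \rho c^{(k)} - (\rho-1-\rho^{-k})\pi^{(k)}\big].$$ *Multipliers for $f$:* for $i\in\{0,\dots,n,*\}$, $j\in\{0,\dots,n\}$, the row $(\lambda^{(k)}_{*,j})_j$ is $[\pi^{(k)},\rho^k]$ and the other rows are $\bar\lambda^{(k)}$, where $\bar\lambda^{(1)}_{0,1} = \rho$, $\bar\lambda^{(1)}_{1,0} = 1$, $\bar\lambda^{(1)}_{0,0} = \bar\lambda^{(1)}_{1,1} = 0$, and, with $n=2^k-1$, $$\begin{aligned}\bar\lambda^{(k+1)}_{i,j} ={}& \bar\lambda^{(k)}_{i,j}\mathbf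 1_{\{0\le i,j\le n\}} + \rho^2\bar\lambda^{(k)}_{i-n-1,j-n-1}\mathbf 1_{\{n+1\le i,j\le 2n+1\}} + \rho\,\mathbf 1_{\{(i,j)=(n,2n+1)\}} + \rho^k\mathbf 1_{\{(i,j)=(2n+1,n)\}}\\ &+ \rho\,\pi^{(k)}_{j-n}\mathbf 1_{\{i\in\{n,2n+1\},\ n+1\le j\le 2n\}}.\end{aligned}$$ *Multipliers for $h$:* for $i\in\{1,\dots,n,*\}$, $j\in\{1,\dots,n\}$, the row $(\mu^{(k)}_{*,j})_j$ is $c^{(k)}+e_1$ and the other rows are $\bar\mu^{(k)}$, where $\bar\mu^{(1)} = [0]$ and, with $n=2^k-1$ and $D=\rho^{k-1}+1$, $$\begin{aligned}\bar\mu^{(k+1)}_{i,j} ={}& \bar\mu^{(k)}_{i,j}\mathbf 1_{\{1\le i,j\le n\}} + \rho^2\bar\mu^{(k)}_{i-n-1,j-n-1}\mathbf 1_{\{n+2\le i,j\le 2n+1\}}\\ &+ \rho^k\mathbf 1_{\{(i,j)=(n,n+1)\}} + \rho^2\mathbf 1_{\{(i,j)=(n+1,n+2)\}} + (\rho-\rho^{-k})D\,\mathbf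 1_{\{(i,j)=(2n+1,n+1)\}}\\ &+ \big(1-\tfrac{\rho^k}{D}\big)(c^{(k)}_j-\pi^{(k)}_j)\mathbf 1_{\{i=n,\,1\le j\le n\}} + \tfrac{\rho^k}{D}(c^{(k)}_j-\pi^{(k)}_j)\mathbf 1_{\{i=n+1,\,1\le j\le n\}}\\ &+ \tfrac{\rho^k}{D}\pi^{(k)}_{j-n-1}\mathbf 1_{\{i=n,\,n+2\le j\le 2n+1\}} + \tfrac{\rho}{D}\pi^{(k)}_{j-n-1}\mathbf 1_{\{i=n+1,\,n+2\le j\le 2n+1\}}\\ &+ \big((\rho+1)c^{(k)}_{j-n-1}-(1+\rho^{-k})\pi^{(k)}_{j-n-1}\big)\mathbf 1_{\{i=2n+1,\,n+2\le j\le 2n+1\}}.\end{aligned}$$ *Slack matrix:* with $\delta^{(k)} = c^{(k)}-\pi^{(k)}$, let $\bar L^{(1)} = [2(\rho-1)]$ and $$\bar L^{(k+1)} = \begin{bmatrix}\bar L^{(k)}+\delta^{(k)}\delta^{(k)T} & -\rho^k\delta^{(k)} & 0\\ -\rho^k\delta^{(k)T} & (\rho^{k-1}+1)(\rho^{k+1}+1)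 & -\rho\,\pi^{(k)T}\\ 0 & -\rho\,\pi^{(k)} & \rho^2(\bar L^{(k)}+\delta^{(k)}\delta^{(k)T})\end{bmatrix} - \delta^{(k+1)}\delta^{(k+1)T},$$ $$L^{(k)} = \begin{bmatrix}\bar L^{(k)} & -c^{(k)}\\ -c^{(k)T} & 2(\rho^k-1)\end{bmatrix},\qquad S^{(k)} = \begin{bmatrix}\tfrac1{\sqrt2} & (-e_1+e_{n+1})^T\\ -e_1+e_{n+1} & L^{(k)}\end{bmatrix}\in\mathbb R^{(n+2)\times(n+2)}.$$ Then for every integer $k\ge1$, with $n=2^k-1$, $\lambda=\lambda^{(k)}$, $\mu=\mu^{(k)}$, $S=S^{(k)}$, $c=c^{(k)}$: (i) $\lambda_{i,j}\ge0$ and $\mu_{i,j}\ge0$ for all $i\ne j$; (ii) $S$ is symmetric positive semidefinite; (iii) Let $f:\mathbb R^d\to\mathbb R$ be convex and $1$-smooth, let $h:\mathbb R^d\to\mathbb R\cup\{+\infty\}$ be proper and convex, let $x_*$ be a minimizer of $F=f+h$, and let $x_0,\dots,x_n$ be iterates of proximal gradient descent with silver stepsizes, i.e. $x_{t+1}$ is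 a minimizer of $z\mapsto h(z)+\frac1{2\alpha_t}\|z-(x_t-\alpha_t\nabla f(x_t))\|^2$. Write $f_i=f(x_i)$, $g_i=\nabla f(x_i)$, $h_i=h(x_i)$, $F_i=F(x_i)$, and define $s_1,\dots,s_n,s_*$ by $x_{t+1}=x_t-\alpha_t(g_t+s_{t+1})$ and $g_*+s_*=0$. Then each $s_i$ ($i\in\{1,\dots,n,*\}$) is a subgradient of $h$ at $x_i$, and with $Q^f_{ij}=f_i-f_j-\langle g_j,x_i-x_j\rangle-\frac12\|g_i-g_j\|^2$ and $Q^h_{ij}=h_i-h_j-\langle s_j,x_i-x_j\rangle$, $$\sum_{i,j}\lambda_{i,j}Q^f_{ij}+\sum_{i,j}\mu_{i,j}Q^h_{ij}=(2\rho^k-1)(F_*-F_n)+\frac{\rho}{2\sqrt2}\|x_0-x_*\|^2-\frac12\big(\|u\|^2+\mathrm{Tr}(VSV^T)\big),$$ where $u=x_0-x_*-\sum_{i=0}^{n-1}\alpha_ig_i-\rho^kg_n-\sum_{j=1}^nc_js_j-s_*$ and $V=[\,x_0-x_*\mid s_1\mid\cdots\mid s_n\mid s_*\,]$. -/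

import Mathlib

namespace SilverProx

noncomputable section

/-! ### The silver stepsizes and the auxiliary sequence -/

/-- The silver ratio `ρ = 1 + √2`. -/
def rho : ℝ := 1 + Real.sqrt 2

/-- The silver stepsize schedule `α_t = ρ ^ (ν(t+1) - 1) + 1`, `t = 0, 1, 2, …`, with `ν` the
2-adic valuation (the exponent is an integer, possibly `-1`). -/
def silverStep (t : ℕ) : ℝ := rho ^ ((padicValNat 2 (t + 1) : ℤ) - 1) + 1

/-- The horizon `n = 2 ^ k - 1`. -/
def horizon (k : ℕ) : ℕ := 2 ^ k - 1

/-- `π^{(k)} = [α_0, …, α_{n-1}]` as a vector with entries `1, …, n`, where `n = 2 ^ k - 1`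
(extended by `0` to the other indices). -/
def piSeq (k j : ℕ) : ℝ :=
  if 1 ≤ j ∧ j ≤ horizon k then silverStep (j - 1) else 0

/-- The vector `c^{(k)}` for `k ≥ 1`, with entries `1, …, n`, where `n = 2 ^ k - 1` (extended by `0`
to the other indices; the value at `k = 0` is a dummy). -/
def cSeq : ℕ → ℕ → ℝ
  | 0, _ => 0
  | 1, j => if j = 1 then 2 * (rho - 1) else 0
  | k + 2, j =>
    if 1 ≤ j ∧ j ≤ horizon (k + 1) then
      piSeq (k + 1) j
    else if j = horizon (k + 1) + 1 then
      (1 + 1 / rho ^ (k + 1)) * (rho ^ k + 1)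
    else if horizon (k + 1) + 2 ≤ j ∧ j ≤ 2 * horizon (k + 1) + 1 then
      rho * cSeq (k + 1) (j - horizon (k + 1) - 1)
        - (rho - 1 - 1 / rho ^ (k + 1)) * piSeq (k + 1) (j - horizon (k + 1) - 1)
    else 0

/-! ### Multipliers for `f`

In the step definitions below, `k ≥ 1` is the current level, `n = horizon k`, and the result is the
corresponding component at level `k + 1`. -/

/-- Recursion component (two glued copies of the previous level `B`). -/
def lamRec (k : ℕ) (B : ℕ → ℕ → ℝ) (i j : ℕ) : ℝ :=
  (if i ≤ horizon k ∧ j ≤ horizon k then B i j else 0)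
    + (if (horizon k + 1 ≤ i ∧ i ≤ 2 * horizon k + 1) ∧
          (horizon k + 1 ≤ j ∧ j ≤ 2 * horizon k + 1) then
        rho ^ 2 * B (i - horizon k - 1) (j - horizon k - 1) else 0)

/-- Sparse correction. -/
def lamSparse (k i j : ℕ) : ℝ :=
  (if i = horizon k ∧ j = 2 * horizon k + 1 then rho else 0)
    + (if i = 2 * horizon k + 1 ∧ j = horizon k then rho ^ k else 0)

/-- Low-rank correction. -/
def lamLowRank (k i j : ℕ) : ℝ :=
  (if i = horizon k ∧ horizon k + 1 ≤ j ∧ j ≤ 2 * horizon k then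
      rho * piSeq k (j - horizon k) else 0)
    + (if i = 2 * horizon k + 1 ∧ horizon k + 1 ≤ j ∧ j ≤ 2 * horizon k then
      rho * piSeq k (j - horizon k) else 0)

/-- The block of multipliers `λ_{i,j}`, `i, j ∈ {0, …, n}` (dummy at `k = 0`). -/
def lamBar : ℕ → ℕ → ℕ → ℝ
  | 0, _, _ => 0
  | 1, i, j => if i = 0 ∧ j = 1 then rho else if i = 1 ∧ j = 0 then 1 else 0
  | k + 2, i, j =>
    lamRec (k + 1) (lamBar (k + 1)) i j + lamSparse (k + 1) i j + lamLowRank (k + 1) i j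

/-- The row `λ_{*,j}`, `j ∈ {0, …, n}`: the vector `[π^{(k)}, ρ^k]`. -/
def lamStar (k j : ℕ) : ℝ :=
  if j < horizon k then piSeq k (j + 1) else if j = horizon k then rho ^ k else 0

/-- The multipliers `λ^{(k)}_{i,j}`, `i ∈ {0, …, n, *}`, `j ∈ {0, …, n}`. Indices in
`{0, 1, 2, …, *}` are terms of `Option ℕ`, with `none` playing the role of `*`. -/
def lam (k : ℕ) : Option ℕ → ℕ → ℝ
  | some i, j => lamBar k i j
  | none, j => lamStar k j

/-! ### Multipliers for `h` -/

/-- Recursion component (two glued copies of the previous level `B`). -/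
def muRec (k : ℕ) (B : ℕ → ℕ → ℝ) (i j : ℕ) : ℝ :=
  (if (1 ≤ i ∧ i ≤ horizon k) ∧ (1 ≤ j ∧ j ≤ horizon k) then B i j else 0)
    + (if (horizon k + 2 ≤ i ∧ i ≤ 2 * horizon k + 1) ∧
          (horizon k + 2 ≤ j ∧ j ≤ 2 * horizon k + 1) then
        rho ^ 2 * B (i - horizon k - 1) (j - horizon k - 1) else 0)

/-- Sparse correction. -/
def muSparse (k i j : ℕ) : ℝ :=
  (if i = horizon k ∧ j = horizon k + 1 then rho ^ k else 0)
    + (if i = horizon k + 1 ∧ j = horizon k + 2 then rho ^ 2 else 0)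
    + (if i = 2 * horizon k + 1 ∧ j = horizon k + 1 then
        (rho - 1 / rho ^ k) * (rho ^ (k - 1) + 1) else 0)

/-- Low-rank correction. -/
def muLowRank (k i j : ℕ) : ℝ :=
  (if i = horizon k ∧ 1 ≤ j ∧ j ≤ horizon k then
      (1 - rho ^ k / (rho ^ (k - 1) + 1)) * (cSeq k j - piSeq k j) else 0)
    + (if i = horizon k + 1 ∧ 1 ≤ j ∧ j ≤ horizon k then
      rho ^ k / (rho ^ (k - 1) + 1) * (cSeq k j - piSeq k j) else 0)
    + (if i = horizon k ∧ horizon k + 2 ≤ j ∧ j ≤ 2 * horizon k + 1 then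
      rho ^ k / (rho ^ (k - 1) + 1) * piSeq k (j - horizon k - 1) else 0)
    + (if i = horizon k + 1 ∧ horizon k + 2 ≤ j ∧ j ≤ 2 * horizon k + 1 then
      rho / (rho ^ (k - 1) + 1) * piSeq k (j - horizon k - 1) else 0)
    + (if i = 2 * horizon k + 1 ∧ horizon k + 2 ≤ j ∧ j ≤ 2 * horizon k + 1 then
      (rho + 1) * cSeq k (j - horizon k - 1)
        - (1 + 1 / rho ^ k) * piSeq k (j - horizon k - 1) else 0)

/-- The block of multipliers `μ_{i,j}`, `i, j ∈ {1, …, n}` (it is `0` at `k = 1`, and a dummy at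
`k = 0`). -/
def muBar : ℕ → ℕ → ℕ → ℝ
  | 0, _, _ => 0
  | 1, _, _ => 0
  | k + 2, i, j =>
    muRec (k + 1) (muBar (k + 1)) i j + muSparse (k + 1) i j + muLowRank (k + 1) i j

/-- The row `μ_{*,j}`, `j ∈ {1, …, n}`: the vector `c^{(k)} + e_1`. -/
def muStar (k j : ℕ) : ℝ := cSeq k j + (if j = 1 then 1 else 0)

/-- The multipliers `μ^{(k)}_{i,j}`, `i ∈ {1, …, n, *}`, `j ∈ {1, …, n}`, with `none` for `*`. -/
def mu (k : ℕ) : Option ℕ → ℕ → ℝ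
  | some i, j => muBar k i j
  | none, j => muStar k j

/-! ### The slack matrix -/

/-- Entries of `c^{(k)} - π^{(k)}`. -/
def cSubPi (k i : ℕ) : ℝ := cSeq k i - piSeq k i

/-- Entries `i, j ∈ {1, …, n}` of the `n × n` matrix `L̄^{(k)}` (dummy at `k = 0`). At level `k + 1`
the index set `{1, …, 2n+1}` is split into the blocks `{1, …, n}`, `{n+1}`, `{n+2, …, 2n+1}`. -/
def LBar : ℕ → ℕ → ℕ → ℝ
  | 0, _, _ => 0
  | 1, i, j => if i = 1 ∧ j = 1 then 2 * (rho - 1) else 0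
  | k + 2, i, j =>
    let n := horizon (k + 1)
    ((if (1 ≤ i ∧ i ≤ n) ∧ (1 ≤ j ∧ j ≤ n) then
        LBar (k + 1) i j + cSubPi (k + 1) i * cSubPi (k + 1) j else 0)
      + (if (n + 2 ≤ i ∧ i ≤ 2 * n + 1) ∧ (n + 2 ≤ j ∧ j ≤ 2 * n + 1) then
        rho ^ 2 * (LBar (k + 1) (i - n - 1) (j - n - 1)
          + cSubPi (k + 1) (i - n - 1) * cSubPi (k + 1) (j - n - 1)) else 0))
    + ((if (1 ≤ i ∧ i ≤ n) ∧ j = n + 1 then -rho ^ (k + 1) * cSubPi (k + 1) i else 0)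
      + (if i = n + 1 ∧ (1 ≤ j ∧ j ≤ n) then -rho ^ (k + 1) * cSubPi (k + 1) j else 0)
      + (if i = n + 1 ∧ j = n + 1 then (rho ^ k + 1) * (rho ^ (k + 2) + 1) else 0)
      + (if i = n + 1 ∧ (n + 2 ≤ j ∧ j ≤ 2 * n + 1) then
        -rho * piSeq (k + 1) (j - n - 1) else 0)
      + (if (n + 2 ≤ i ∧ i ≤ 2 * n + 1) ∧ j = n + 1 then
        -rho * piSeq (k + 1) (i - n - 1) else 0))
    - cSubPi (k + 2) i * cSubPi (k + 2) j

/-- Entries `i, j ∈ {1, …, n + 1}` of `L^{(k)} = [[L̄, -c], [-cᵀ, 2(ρ^k - 1)]]`. -/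
def LEntry (k i j : ℕ) : ℝ :=
  if i ≤ horizon k then
    if j ≤ horizon k then LBar k i j else -cSeq k i
  else
    if j ≤ horizon k then -cSeq k j else 2 * (rho ^ k - 1)

/-- Entries of the vector `-e_1 + e_{n+1}`. -/
def eVec (k j : ℕ) : ℝ :=
  -(if j = 1 then 1 else 0) + (if j = horizon k + 1 then 1 else 0)

/-- The slack matrix `S^{(k)} = [[1/√2, (-e_1 + e_{n+1})ᵀ], [-e_1 + e_{n+1}, L^{(k)}]]`, of size
`(n + 2) × (n + 2)`; row and column `0` come first, and index `j ≥ 1` of `S` is index `j` of `L`. -/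
def slack (k : ℕ) : Matrix (Fin (horizon k + 2)) (Fin (horizon k + 2)) ℝ :=
  Matrix.of fun i j =>
    if (i : ℕ) = 0 then
      if (j : ℕ) = 0 then 1 / Real.sqrt 2 else eVec k j
    else
      if (j : ℕ) = 0 then eVec k i else LEntry k i j

/-! ### Convex composite optimization and proximal gradient descent -/

/-- `f` is `1`-smooth: differentiable with `1`-Lipschitz gradient. -/
def OneSmooth {d : ℕ} (f : EuclideanSpace ℝ (Fin d) → ℝ) : Prop :=
  Differentiable ℝ f ∧ LipschitzWith 1 (gradient f)

/-- A proper convex function with values in the extended reals: never `-∞`, not identically `+∞`,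
with convex epigraph. Indicator functions of nonempty convex sets are allowed. -/
def ProperConvex {d : ℕ} (h : EuclideanSpace ℝ (Fin d) → EReal) : Prop :=
  (∀ x, h x ≠ ⊥) ∧ (∃ x, h x ≠ ⊤) ∧
    Convex ℝ {p : EuclideanSpace ℝ (Fin d) × ℝ | h p.1 ≤ (p.2 : EReal)}

/-- `s` is a subgradient of `h` at `x` (in particular `h x` is finite). -/
def IsSubgradient {d : ℕ} (h : EuclideanSpace ℝ (Fin d) → EReal)
    (x s : EuclideanSpace ℝ (Fin d)) : Prop :=
  h x ≠ ⊥ ∧ h x ≠ ⊤ ∧ ∀ y, h x + ((inner ℝ s (y - x) : ℝ) : EReal) ≤ h y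

/-- `p = prox_{α h}(w)`, that is, `p` minimizes `z ↦ h z + ‖z - w‖² / (2 α)`. -/
def IsProx {d : ℕ} (h : EuclideanSpace ℝ (Fin d) → EReal) (α : ℝ)
    (w p : EuclideanSpace ℝ (Fin d)) : Prop :=
  ∀ z, h p + ((1 / (2 * α) * ‖p - w‖ ^ 2 : ℝ) : EReal)
    ≤ h z + ((1 / (2 * α) * ‖z - w‖ ^ 2 : ℝ) : EReal)

/-- `x_0, …, x_n` are iterates of proximal gradient descent for `f + h` with the silver stepsizes:
`x_{t+1} = prox_{α_t h}(x_t - α_t ∇f(x_t))` for `t < n`. -/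
def IsSilverProxGD {d : ℕ} (f : EuclideanSpace ℝ (Fin d) → ℝ)
    (h : EuclideanSpace ℝ (Fin d) → EReal) (n : ℕ)
    (x : Option ℕ → EuclideanSpace ℝ (Fin d)) : Prop :=
  ∀ t < n, IsProx h (silverStep t)
    (x (some t) - silverStep t • gradient f (x (some t))) (x (some (t + 1)))

/-- `xs` is a minimizer of `F = f + h`. -/
def IsMinimizer {d : ℕ} (f : EuclideanSpace ℝ (Fin d) → ℝ)
    (h : EuclideanSpace ℝ (Fin d) → EReal) (xs : EuclideanSpace ℝ (Fin d)) : Prop :=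
  ∀ z, (f xs : EReal) + h xs ≤ (f z : EReal) + h z

/-! ### Co-coercivities and the terms of the descent identity

A family `x : Option ℕ → ℝ^d` lists the points `x_0, x_1, …` (`some i`) and `x_*` (`none`), and
likewise for `s`. The finite values of `h` are read off by `EReal.toReal`. -/

/-- `Q^f_{ij} = f_i - f_j - ⟨g_j, x_i - x_j⟩ - ½ ‖g_i - g_j‖²`, where `g_i = ∇f(x_i)`. -/
def Qf {d : ℕ} (f : EuclideanSpace ℝ (Fin d) → ℝ)
    (x : Option ℕ → EuclideanSpace ℝ (Fin d)) (i j : Option ℕ) : ℝ :=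
  f (x i) - f (x j) - inner ℝ (gradient f (x j)) (x i - x j)
    - 1 / 2 * ‖gradient f (x i) - gradient f (x j)‖ ^ 2

/-- `Q^h_{ij} = h_i - h_j - ⟨s_j, x_i - x_j⟩`. -/
def Qh {d : ℕ} (h : EuclideanSpace ℝ (Fin d) → EReal)
    (x s : Option ℕ → EuclideanSpace ℝ (Fin d)) (i j : Option ℕ) : ℝ :=
  (h (x i)).toReal - (h (x j)).toReal - inner ℝ (s j) (x i - x j)

/-- `F_i = f(x_i) + h(x_i)`. -/
def Fval {d : ℕ} (f : EuclideanSpace ℝ (Fin d) → ℝ) (h : EuclideanSpace ℝ (Fin d) → EReal)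
    (x : Option ℕ → EuclideanSpace ℝ (Fin d)) (i : Option ℕ) : ℝ :=
  f (x i) + (h (x i)).toReal

/-- `u = x_0 - x_* - ∑_{i=0}^{n-1} α_i g_i - ρ^k g_n - ∑_{j=1}^n c_j s_j - s_*`. -/
def uVec {d : ℕ} (k : ℕ) (f : EuclideanSpace ℝ (Fin d) → ℝ)
    (x s : Option ℕ → EuclideanSpace ℝ (Fin d)) : EuclideanSpace ℝ (Fin d) :=
  x (some 0) - x none
    - ∑ i ∈ Finset.range (horizon k), silverStep i • gradient f (x (some i))
    - rho ^ k • gradient f (x (some (horizon k)))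
    - ∑ j ∈ Finset.Icc 1 (horizon k), cSeq k j • s (some j)
    - s none

/-- The `d × (n + 2)` matrix `V = [x_0 - x_* | s_1 | … | s_n | s_*]`. -/
def VMat {d : ℕ} (k : ℕ) (x s : Option ℕ → EuclideanSpace ℝ (Fin d)) :
    Matrix (Fin d) (Fin (horizon k + 2)) ℝ :=
  Matrix.of fun a j =>
    if (j : ℕ) = 0 then (x (some 0) - x none) a
    else if (j : ℕ) ≤ horizon k then s (some j) a
    else s none a

/-- The index set `{0, 1, …, n, *}`. -/
def idxF (k : ℕ) : Finset (Option ℕ) := Finset.insertNone (Finset.range (horizon k + 1))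

/-- The index set `{1, …, n, *}`. -/
def idxH (k : ℕ) : Finset (Option ℕ) := Finset.insertNone (Finset.Icc 1 (horizon k))

end

end SilverProx

/-!
Everything is proved by induction on the level, through the recursions from level `k` to `k + 1`.
The indices `1, …, 2n + 1` of level `k + 1` split into the blocks `{1, …, n}`, `{n + 1}`,
`{n + 2, …, 2n + 1}`, and the two outer blocks carry copies of level `k`. Write `δ = c - π`; it is
nonnegative, and at level `k + 1` it vanishes on the first block.

*Nonnegativity.* In the recursion for `μ̄` the only term that can be negative is the multiple
`1 - ρ ^ k / (ρ ^ (k - 1) + 1)` of `δ_j` in the row `i = n`. The factor is at least `1 - ρ`, and the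
term is added to the last row of level `k`, which off the diagonal is at least `(ρ - 1) δ_j`
(`le_muBar_last_row`), an inequality that propagates because `ρ ^ 2 = 2ρ + 1`.

*The slack matrix.* `L̄ + δ δᵀ` (`LHat`) has a block recursion without rank-one correction. Hence
its off-diagonal entries are nonpositive, so are those of `L̄`, and the row sums of `L̄` are the
entries of `c` (`sum_LBar_row`). As the entries of `c` are nonnegative and their sum is
`2 (ρ ^ k - 1)`, the matrix `L` is a weighted graph Laplacian. Completing the square in the coordinate `0`
of `S` costs `√2 (y_1 - y_*) ^ 2`, which is available since the weight `c_1` between `1` and `*`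
is at least `α_0 = √2` (`slack_posSemidef`).

*The identity.* It holds for arbitrary scalars `f_i`, `h_i` and vectors `g_i`, `s_i`, provided the
points follow the update rule and `g_* + s_* = 0` (`descent_identity`). The rows with `i ≠ *` do
not see the minimizer, and their total has a closed form (`sum_multipliers`), proved by induction:
after summation, the terms of the recursion depend on the two copies of level `k` only through a
few weighted sums of `g` and `s`, and what remains is a polynomial identity between inner products
of nine vectors (`glue_identity`). The row `*` is then added by a direct computation.

The subgradient property is first-order optimality in the proximal step and at the minimizer
(`isSubgradient_of_forall_le`).
-/

/-! ### The silver ratio, the stepsizes and the vector `c` -/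

namespace SilverProx

theorem rho_sq : rho ^ 2 = 2 * rho + 1 := by
  have h : Real.sqrt 2 ^ 2 = 2 := Real.sq_sqrt (by norm_num)
  unfold rho
  linear_combination h

theorem sqrt_two_eq : Real.sqrt 2 = rho - 1 := by
  unfold rho; ring

theorem one_lt_rho : 1 < rho := by
  have h : 0 < Real.sqrt 2 := Real.sqrt_pos.2 (by norm_num)
  unfold rho; linarith

theorem rho_pos : 0 < rho := one_pos.trans one_lt_rho

theorem rho_inv : rho⁻¹ = rho - 2 :=
  inv_eq_of_mul_eq_one_right (by linear_combination rho_sq)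

theorem silverStep_pos (t : ℕ) : 0 < silverStep t := by
  have := rho_pos
  unfold silverStep
  positivity

theorem silverStep_zero : silverStep 0 = rho - 1 := by
  simp [silverStep, rho_inv]
  ring

theorem horizon_add_one (k : ℕ) : horizon k + 1 = 2 ^ k :=
  Nat.sub_add_cancel Nat.one_le_two_pow

theorem horizon_succ (k : ℕ) : horizon (k + 1) = 2 * horizon k + 1 := by
  have h₀ := horizon_add_one k
  have h₁ := horizon_add_one (k + 1)
  rw [pow_succ] at h₁
  omega

theorem horizon_add_two (k : ℕ) : horizon (k + 2) = 2 * horizon (k + 1) + 1 :=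
  horizon_succ (k + 1)

theorem horizon_one : horizon 1 = 1 := rfl

theorem horizon_succ_pos (k : ℕ) : 1 ≤ horizon (k + 1) := by
  rw [horizon_succ]; omega

theorem silverStep_horizon (k : ℕ) : silverStep (horizon (k + 1)) = rho ^ k + 1 := by
  rw [silverStep, horizon_add_one, padicValNat.prime_pow]
  push_cast
  rw [add_sub_cancel_right, zpow_natCast]

theorem padicValNat_two_pow_add {k m : ℕ} (h₀ : m ≠ 0) (h : m < 2 ^ k) :
    padicValNat 2 (2 ^ k + m) = padicValNat 2 m := by
  refine le_antisymm ?_ ?_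
  · by_contra! hlt
    have h₁ : 2 ^ (padicValNat 2 m + 1) ∣ 2 ^ k + m :=
      (padicValNat_dvd_iff_le (by omega)).2 hlt
    have h₂ : padicValNat 2 m + 1 ≤ k := by
      have := Nat.le_of_dvd (by omega) (pow_padicValNat_dvd (p := 2) (n := m))
      exact (Nat.pow_lt_pow_iff_right (by norm_num)).1 (this.trans_lt h)
    have h₃ := (Nat.dvd_add_right (pow_dvd_pow 2 h₂)).1 h₁
    exact absurd ((padicValNat_dvd_iff_le h₀).1 h₃) (by omega)
  · refine (padicValNat_dvd_iff_le (by omega)).1 (dvd_add ?_ pow_padicValNat_dvd)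
    refine pow_dvd_pow 2 ?_
    have := Nat.le_of_dvd (by omega) (pow_padicValNat_dvd (p := 2) (n := m))
    exact ((Nat.pow_lt_pow_iff_right (by norm_num)).1 (this.trans_lt h)).le

/-- The silver schedule of level `k + 1` repeats that of level `k` after its middle step. -/
theorem silverStep_shift {k t : ℕ} (h : t < horizon k) :
    silverStep (horizon k + 1 + t) = silverStep t := by
  have h₁ := horizon_add_one k
  rw [silverStep, silverStep, h₁, add_assoc, padicValNat_two_pow_add (by omega) (by omega)]

theorem piSeq_succ_left {k j : ℕ} (h : j < horizon k) : piSeq k (j + 1) = silverStep j := by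
  rw [piSeq, if_pos (by omega), Nat.add_sub_cancel]

theorem cSeq_one : cSeq 1 1 = 2 * (rho - 1) := by simp [cSeq]

variable (k : ℕ)

theorem cSeq_left {j : ℕ} (h : j < horizon (k + 1)) :
    cSeq (k + 2) (j + 1) = silverStep j := by
  rw [cSeq, if_pos (by omega), piSeq_succ_left h]

theorem cSeq_mid :
    cSeq (k + 2) (horizon (k + 1) + 1) = (1 + 1 / rho ^ (k + 1)) * (rho ^ k + 1) := by
  rw [cSeq, if_neg (by omega), if_pos rfl]

theorem cSeq_right {j : ℕ} (h : j < horizon (k + 1)) :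
    cSeq (k + 2) (horizon (k + 1) + 1 + j + 1)
      = rho * cSeq (k + 1) (j + 1) - (rho - 1 - 1 / rho ^ (k + 1)) * silverStep j := by
  have e : horizon (k + 1) + 1 + j + 1 - horizon (k + 1) - 1 = j + 1 := by omega
  rw [cSeq, if_neg (by omega), if_neg (by omega), if_pos (by omega), e, piSeq_succ_left h]

theorem cSubPi_eq {k j : ℕ} (h : j < horizon k) :
    cSubPi k (j + 1) = cSeq k (j + 1) - silverStep j := by
  rw [cSubPi, piSeq_succ_left h]

theorem cSubPi_left {j : ℕ} (h : j < horizon (k + 1)) : cSubPi (k + 2) (j + 1) = 0 := by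
  have := horizon_add_two k
  rw [cSubPi_eq (by omega), cSeq_left k h, sub_self]

theorem cSubPi_mid :
    cSubPi (k + 2) (horizon (k + 1) + 1) = 1 / rho ^ (k + 1) * (rho ^ k + 1) := by
  have := horizon_add_two k
  rw [cSubPi_eq (by omega), cSeq_mid, silverStep_horizon]
  ring

theorem cSubPi_right {j : ℕ} (h : j < horizon (k + 1)) :
    cSubPi (k + 2) (horizon (k + 1) + 1 + j + 1)
      = rho * cSubPi (k + 1) (j + 1) + 1 / rho ^ (k + 1) * silverStep j := by
  have := horizon_add_two k
  rw [cSubPi_eq (by omega), cSeq_right k h, silverStep_shift h, cSubPi_eq h]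
  ring

/-- Splitting a sum over the `2n + 1` indices of level `k + 1` into the two copies of level `k`
and the index between them. -/
theorem sum_range_glue {M : Type*} [AddCommMonoid M] (n : ℕ) (F : ℕ → M) :
    ∑ i ∈ Finset.range (2 * n + 1), F i
      = ∑ i ∈ Finset.range n, F i + F n + ∑ i ∈ Finset.range n, F (n + 1 + i) := by
  rw [show 2 * n + 1 = n + 1 + n by ring, Finset.sum_range_add, Finset.sum_range_succ]

theorem sum_silverStep :
    ∑ t ∈ Finset.range (horizon (k + 1)), silverStep t = rho ^ (k + 1) - 1 := by
  induction k with
  | zero => simp [horizon_one, silverStep_zero]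
  | succ k ih =>
    rw [horizon_succ, sum_range_glue, silverStep_horizon,
      Finset.sum_congr rfl fun t ht => silverStep_shift (Finset.mem_range.1 ht), ih]
    linear_combination (-rho ^ k) * rho_sq

theorem sum_cSeq :
    ∑ j ∈ Finset.range (horizon (k + 1)), cSeq (k + 1) (j + 1) = 2 * (rho ^ (k + 1) - 1) := by
  induction k with
  | zero => simp [horizon_one, cSeq_one]
  | succ k ih =>
    have hr := rho_pos.ne'
    rw [horizon_succ, sum_range_glue, cSeq_mid,
      Finset.sum_congr rfl fun j hj => cSeq_left k (Finset.mem_range.1 hj),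
      Finset.sum_congr rfl fun j hj => cSeq_right k (Finset.mem_range.1 hj),
      Finset.sum_sub_distrib, ← Finset.mul_sum, ← Finset.mul_sum, ih, sum_silverStep]
    have h : 1 / rho ^ (k + 1) * rho ^ k = rho - 2 := by
      rw [← rho_inv, pow_succ]; field_simp
    have h' : 1 / rho ^ (k + 1) * rho ^ (k + 1) = 1 := by field_simp
    linear_combination h + h' - rho ^ k * rho_sq

/-- An index of level `k + 1`, counted from `0`, lies in the first copy of level `k`, between the
copies, or in the second copy. -/
theorem glue_cases {n j : ℕ} (h : j < 2 * n + 1) :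
    j < n ∨ j = n ∨ ∃ i < n, j = n + 1 + i := by
  by_cases h₁ : j < n
  · exact .inl h₁
  by_cases h₂ : j = n
  · exact .inr (.inl h₂)
  · exact .inr (.inr ⟨j - (n + 1), by omega, by omega⟩)

theorem cSubPi_nonneg {j : ℕ} (h : j < horizon (k + 1)) : 0 ≤ cSubPi (k + 1) (j + 1) := by
  have hr := rho_pos
  induction k generalizing j with
  | zero =>
    have := one_lt_rho
    rw [zero_add, horizon_one] at h
    obtain rfl : j = 0 := by omega
    rw [cSubPi_eq (by simp [horizon_one]), cSeq_one, silverStep_zero]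
    linarith
  | succ k ih =>
    rw [horizon_succ] at h
    obtain h' | rfl | ⟨i, hi, rfl⟩ := glue_cases h
    · exact (cSubPi_left k h').ge
    · rw [cSubPi_mid]; positivity
    · rw [cSubPi_right k hi]
      have := ih hi
      have := silverStep_pos i
      positivity

theorem silverStep_le_cSeq {j : ℕ} (h : j < horizon (k + 1)) :
    silverStep j ≤ cSeq (k + 1) (j + 1) := by
  have := cSubPi_nonneg k h
  rw [cSubPi_eq h] at this
  linarith

end SilverProx

/-! ### Block form and nonnegativity of the multipliers -/

namespace SilverProx

theorem piSeq_nonneg (k j : ℕ) : 0 ≤ piSeq k j := by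
  unfold piSeq
  split_ifs
  exacts [(silverStep_pos _).le, le_rfl]

theorem lamBar_nonneg (k i j : ℕ) : 0 ≤ lamBar k i j := by
  have hr := rho_pos
  induction k generalizing i j with
  | zero => exact le_rfl
  | succ k ih =>
    cases k with
    | zero => rw [lamBar]; split_ifs <;> positivity
    | succ k =>
      have h₁ := ih i j
      have h₂ := ih (i - horizon (k + 1) - 1) (j - horizon (k + 1) - 1)
      have h₃ := piSeq_nonneg (k + 1) (j - horizon (k + 1))
      rw [lamBar, lamRec, lamSparse, lamLowRank]
      refine add_nonneg (add_nonneg (add_nonneg ?_ ?_) (add_nonneg ?_ ?_)) (add_nonneg ?_ ?_) <;>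
      · split_ifs <;> positivity

theorem lamStar_nonneg (k j : ℕ) : 0 ≤ lamStar k j := by
  have hr := rho_pos
  have := piSeq_nonneg k (j + 1)
  unfold lamStar
  split_ifs <;> positivity

variable (k : ℕ) {i j : ℕ}

theorem lamBar_left_left (hi : i < horizon (k + 1) + 1) (hj : j < horizon (k + 1) + 1) :
    lamBar (k + 2) i j = lamBar (k + 1) i j := by
  have := horizon_succ_pos k
  rw [lamBar, lamRec, lamSparse, lamLowRank]
  simp (disch := omega) only [if_pos, if_neg]
  ring

theorem lamBar_left_right (hi : i < horizon (k + 1) + 1) (hj : j < horizon (k + 1) + 1) :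
    lamBar (k + 2) i (horizon (k + 1) + 1 + j)
      = if i = horizon (k + 1) then
          rho * (if j = horizon (k + 1) then 1 else silverStep j) else 0 := by
  have := horizon_succ_pos k
  have e : horizon (k + 1) + 1 + j - horizon (k + 1) = j + 1 := by omega
  rw [lamBar, lamRec, lamSparse, lamLowRank, e]
  by_cases h₁ : i = horizon (k + 1) <;> by_cases h₂ : j = horizon (k + 1) <;>
    simp (disch := omega) only [if_pos, if_neg, piSeq_succ_left] <;> ring

theorem lamBar_right_left (hj : j < horizon (k + 1) + 1) :
    lamBar (k + 2) (horizon (k + 1) + 1 + i) j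
      = if i = horizon (k + 1) then if j = horizon (k + 1) then rho ^ (k + 1) else 0 else 0 := by
  have := horizon_succ_pos k
  rw [lamBar, lamRec, lamSparse, lamLowRank]
  by_cases h₁ : i = horizon (k + 1) <;> by_cases h₂ : j = horizon (k + 1) <;>
    simp (disch := omega) only [if_pos, if_neg] <;> ring

theorem lamBar_right_right (hi : i < horizon (k + 1) + 1) (hj : j < horizon (k + 1) + 1) :
    lamBar (k + 2) (horizon (k + 1) + 1 + i) (horizon (k + 1) + 1 + j)
      = rho ^ 2 * lamBar (k + 1) i j
        + if i = horizon (k + 1) then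
            rho * (if j = horizon (k + 1) then 0 else silverStep j) else 0 := by
  have := horizon_succ_pos k
  have e : horizon (k + 1) + 1 + j - horizon (k + 1) = j + 1 := by omega
  have e' (i : ℕ) : horizon (k + 1) + 1 + i - horizon (k + 1) - 1 = i := by omega
  rw [lamBar, lamRec, lamSparse, lamLowRank, e', e', e]
  by_cases h₁ : i = horizon (k + 1) <;> by_cases h₂ : j = horizon (k + 1) <;>
    simp (disch := omega) only [if_pos, if_neg, piSeq_succ_left] <;> ring

theorem muBar_left_left (hi : i < horizon (k + 1)) (hj : j < horizon (k + 1)) :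
    muBar (k + 2) (i + 1) (j + 1)
      = muBar (k + 1) (i + 1) (j + 1)
        + if i + 1 = horizon (k + 1) then
            (1 - rho ^ (k + 1) / (rho ^ k + 1)) * cSubPi (k + 1) (j + 1) else 0 := by
  rw [muBar, muRec, muSparse, muLowRank, Nat.add_sub_cancel, cSubPi]
  by_cases h : i + 1 = horizon (k + 1) <;> simp (disch := omega) only [if_pos, if_neg] <;> ring

theorem muBar_left_mid (hi : i < horizon (k + 1)) :
    muBar (k + 2) (i + 1) (horizon (k + 1) + 1)
      = if i + 1 = horizon (k + 1) then rho ^ (k + 1) else 0 := by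
  rw [muBar, muRec, muSparse, muLowRank, Nat.add_sub_cancel]
  by_cases h : i + 1 = horizon (k + 1) <;>
    simp (disch := omega) only [if_pos, if_neg, and_true] <;> ring

theorem muBar_left_right (hi : i < horizon (k + 1)) (hj : j < horizon (k + 1)) :
    muBar (k + 2) (i + 1) (horizon (k + 1) + 1 + j + 1)
      = if i + 1 = horizon (k + 1) then
          rho ^ (k + 1) / (rho ^ k + 1) * silverStep j else 0 := by
  have e : horizon (k + 1) + 1 + j + 1 - horizon (k + 1) - 1 = j + 1 := by omega
  rw [muBar, muRec, muSparse, muLowRank, Nat.add_sub_cancel, e]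
  by_cases h : i + 1 = horizon (k + 1) <;>
    simp (disch := omega) only [if_pos, if_neg, piSeq_succ_left] <;> ring

theorem muBar_mid_left (hj : j < horizon (k + 1)) :
    muBar (k + 2) (horizon (k + 1) + 1) (j + 1)
      = rho ^ (k + 1) / (rho ^ k + 1) * cSubPi (k + 1) (j + 1) := by
  rw [muBar, muRec, muSparse, muLowRank, Nat.add_sub_cancel, cSubPi]
  simp (disch := omega) only [if_pos, if_neg, true_and]
  ring

theorem muBar_mid_mid :
    muBar (k + 2) (horizon (k + 1) + 1) (horizon (k + 1) + 1) = 0 := by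
  have := horizon_succ_pos k
  rw [muBar, muRec, muSparse, muLowRank]
  simp (disch := omega) only [if_neg, true_and, and_true]
  ring

theorem muBar_mid_right (hj : j < horizon (k + 1)) :
    muBar (k + 2) (horizon (k + 1) + 1) (horizon (k + 1) + 1 + j + 1)
      = (if j = 0 then rho ^ 2 else 0) + rho / (rho ^ k + 1) * silverStep j := by
  have := horizon_succ_pos k
  have e : horizon (k + 1) + 1 + j + 1 - horizon (k + 1) - 1 = j + 1 := by omega
  rw [muBar, muRec, muSparse, muLowRank, Nat.add_sub_cancel, e]
  by_cases h : j = 0 <;>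
    simp (disch := omega) only [if_pos, if_neg, true_and, piSeq_succ_left] <;> ring

theorem muBar_right_left (hj : j < horizon (k + 1)) :
    muBar (k + 2) (horizon (k + 1) + 1 + i + 1) (j + 1) = 0 := by
  rw [muBar, muRec, muSparse, muLowRank]
  simp (disch := omega) only [if_neg]
  ring

theorem muBar_right_mid :
    muBar (k + 2) (horizon (k + 1) + 1 + i + 1) (horizon (k + 1) + 1)
      = if i + 1 = horizon (k + 1) then
          (rho - 1 / rho ^ (k + 1)) * (rho ^ k + 1) else 0 := by
  rw [muBar, muRec, muSparse, muLowRank, Nat.add_sub_cancel]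
  by_cases h : i + 1 = horizon (k + 1) <;>
    simp (disch := omega) only [if_pos, if_neg, and_true] <;> ring

theorem muBar_right_right (hi : i < horizon (k + 1)) (hj : j < horizon (k + 1)) :
    muBar (k + 2) (horizon (k + 1) + 1 + i + 1) (horizon (k + 1) + 1 + j + 1)
      = rho ^ 2 * muBar (k + 1) (i + 1) (j + 1)
        + if i + 1 = horizon (k + 1) then
            (rho + 1) * cSubPi (k + 1) (j + 1) + (rho - 1 / rho ^ (k + 1)) * silverStep j
          else 0 := by
  have e (j : ℕ) : horizon (k + 1) + 1 + j + 1 - horizon (k + 1) - 1 = j + 1 := by omega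
  rw [muBar, muRec, muSparse, muLowRank, Nat.add_sub_cancel, e, e, cSubPi_eq hj]
  by_cases h : i + 1 = horizon (k + 1) <;>
    simp (disch := omega) only [if_pos, if_neg, piSeq_succ_left] <;> ring

theorem rho_pow_div_le : rho ^ (k + 1) / (rho ^ k + 1) ≤ rho := by
  have hr := rho_pos
  rw [div_le_iff₀ (by positivity), pow_succ']
  nlinarith

theorem one_div_rho_pow_le : 1 / rho ^ (k + 1) ≤ 1 :=
  div_le_one_of_le₀ (one_le_pow₀ one_lt_rho.le) (pow_pos rho_pos _).le

/-- The off-diagonal entries of the last row of `μ̄` dominate `(ρ - 1) (c - π)`. This is what makes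
up for the negative coefficient `1 - ρ ^ k / (ρ ^ (k - 1) + 1)` in the recursion for that row. -/
theorem le_muBar_last_row (hj : j + 1 < horizon (k + 1)) :
    (rho - 1) * cSubPi (k + 1) (j + 1) ≤ muBar (k + 1) (horizon (k + 1)) (j + 1) := by
  have hr := one_lt_rho
  induction k generalizing j with
  | zero => simp [horizon_one] at hj
  | succ k ih =>
    rw [horizon_add_two] at hj ⊢
    obtain ⟨m, hm⟩ : ∃ m, horizon (k + 1) = m + 1 :=
      ⟨_, (Nat.sub_add_cancel (horizon_succ_pos k)).symm⟩
    have e : 2 * horizon (k + 1) + 1 = horizon (k + 1) + 1 + m + 1 := by omega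
    have hq := one_div_rho_pow_le k
    rw [e]
    obtain h | rfl | ⟨l, h, rfl⟩ := glue_cases (show j < 2 * horizon (k + 1) + 1 by omega)
    · rw [muBar_right_left k h, cSubPi_left k h, mul_zero]
    · rw [muBar_right_mid k, if_pos hm.symm, cSubPi_mid]
      have h₁ : 0 < rho ^ k + 1 := by positivity
      have h₂ : (rho - 1) * (1 / rho ^ (k + 1)) ≤ rho - 1 / rho ^ (k + 1) := by nlinarith
      nlinarith [mul_le_mul_of_nonneg_right h₂ h₁.le]
    · rw [muBar_right_right k (by omega) h, if_pos hm.symm, cSubPi_right k h]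
      have h₁ := ih (j := l) (by omega)
      have h₂ := cSubPi_nonneg k h
      have h₃ := silverStep_pos l
      have h₄ : 0 ≤ muBar (k + 1) (m + 1) (l + 1) := by
        rw [← hm]
        exact (mul_nonneg (by linarith) h₂).trans h₁
      have h₅ : (rho - 1) * (1 / rho ^ (k + 1)) ≤ rho - 1 / rho ^ (k + 1) := by nlinarith
      have h₆ := mul_le_mul_of_nonneg_right h₅ h₃.le
      have h₇ : 0 ≤ rho ^ 2 * muBar (k + 1) (m + 1) (l + 1) := by positivity
      linear_combination h₆ + h₇ + cSubPi (k + 1) (l + 1) * rho_sq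

theorem muBar_nonneg (hi : i < horizon (k + 1)) (hj : j < horizon (k + 1)) (hij : i ≠ j) :
    0 ≤ muBar (k + 1) (i + 1) (j + 1) := by
  have hr := one_lt_rho
  have hr' := rho_pos
  induction k generalizing i j with
  | zero => exact le_rfl
  | succ k ih =>
    rw [horizon_add_two] at hi hj
    have hq : 0 ≤ rho - 1 / rho ^ (k + 1) := by
      linarith [one_div_rho_pow_le k]
    obtain h | rfl | ⟨a, h, rfl⟩ := glue_cases hi <;>
      obtain h' | rfl | ⟨b, h', rfl⟩ := glue_cases hj
    · rw [muBar_left_left k h h']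
      split_ifs with hn
      · have h₁ := le_muBar_last_row k (j := j) (by omega)
        rw [hn]
        nlinarith [mul_le_mul_of_nonneg_right (rho_pow_div_le k) (cSubPi_nonneg k h')]
      · rw [add_zero]; exact ih h h' hij
    · rw [muBar_left_mid k h]; positivity
    · rw [muBar_left_right k h h']
      have := silverStep_pos b
      positivity
    · rw [muBar_mid_left k h']
      have := cSubPi_nonneg k h'
      positivity
    · rw [muBar_mid_mid]
    · rw [muBar_mid_right k h']
      have := silverStep_pos b
      positivity
    · rw [muBar_right_left k h']
    · rw [muBar_right_mid k]
      positivity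
    · rw [muBar_right_right k h h']
      have h₁ := ih h h' (by omega)
      have h₂ := cSubPi_nonneg k h'
      have h₃ := silverStep_pos b
      positivity

end SilverProx

/-! ### The slack matrix is positive semidefinite -/

namespace SilverProx

/-- The matrix `L̄ + δ δᵀ` with `δ = c - π`. Unlike `L̄` itself, it obeys a block recursion without
a rank-one correction. -/
noncomputable def LHat (k i j : ℕ) : ℝ := LBar k i j + cSubPi k i * cSubPi k j

variable (k : ℕ) {i j : ℕ}

theorem LHat_one : LHat 1 1 1 = 2 * rho := by
  have h := cSubPi_eq (k := 1) (j := 0) one_pos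
  rw [zero_add, cSeq_one, silverStep_zero] at h
  rw [LHat, h, LBar, if_pos ⟨rfl, rfl⟩]
  linear_combination rho_sq

theorem LHat_left_left (hi : i < horizon (k + 1)) (hj : j < horizon (k + 1)) :
    LHat (k + 2) (i + 1) (j + 1) = LHat (k + 1) (i + 1) (j + 1) := by
  rw [LHat, LBar, LHat]
  simp (disch := omega) only [if_pos, if_neg]
  ring

theorem LHat_left_mid (hi : i < horizon (k + 1)) :
    LHat (k + 2) (i + 1) (horizon (k + 1) + 1) = -rho ^ (k + 1) * cSubPi (k + 1) (i + 1) := by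
  rw [LHat, LBar]
  simp (disch := omega) only [if_pos, if_neg, and_true]
  ring

theorem LHat_left_right (hi : i < horizon (k + 1)) :
    LHat (k + 2) (i + 1) (horizon (k + 1) + 1 + j + 1) = 0 := by
  rw [LHat, LBar]
  simp (disch := omega) only [if_neg]
  ring

theorem LHat_mid_left (hj : j < horizon (k + 1)) :
    LHat (k + 2) (horizon (k + 1) + 1) (j + 1) = -rho ^ (k + 1) * cSubPi (k + 1) (j + 1) := by
  rw [LHat, LBar]
  simp (disch := omega) only [if_pos, if_neg, true_and]
  ring

theorem LHat_mid_mid :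
    LHat (k + 2) (horizon (k + 1) + 1) (horizon (k + 1) + 1)
      = (rho ^ k + 1) * (rho ^ (k + 2) + 1) := by
  rw [LHat, LBar]
  simp (disch := omega) only [if_neg, true_and, if_true]
  ring

theorem LHat_mid_right (hj : j < horizon (k + 1)) :
    LHat (k + 2) (horizon (k + 1) + 1) (horizon (k + 1) + 1 + j + 1) = -rho * silverStep j := by
  have e : horizon (k + 1) + 1 + j + 1 - horizon (k + 1) - 1 = j + 1 := by omega
  rw [LHat, LBar, e]
  simp (disch := omega) only [if_pos, if_neg, true_and, piSeq_succ_left]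
  ring

theorem LHat_right_left (hj : j < horizon (k + 1)) :
    LHat (k + 2) (horizon (k + 1) + 1 + i + 1) (j + 1) = 0 := by
  rw [LHat, LBar]
  simp (disch := omega) only [if_neg]
  ring

theorem LHat_right_mid (hi : i < horizon (k + 1)) :
    LHat (k + 2) (horizon (k + 1) + 1 + i + 1) (horizon (k + 1) + 1) = -rho * silverStep i := by
  have e : horizon (k + 1) + 1 + i + 1 - horizon (k + 1) - 1 = i + 1 := by omega
  rw [LHat, LBar, e]
  simp (disch := omega) only [if_pos, if_neg, and_true, piSeq_succ_left]
  ring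

theorem LHat_right_right (hi : i < horizon (k + 1)) (hj : j < horizon (k + 1)) :
    LHat (k + 2) (horizon (k + 1) + 1 + i + 1) (horizon (k + 1) + 1 + j + 1)
      = rho ^ 2 * LHat (k + 1) (i + 1) (j + 1) := by
  have e (i : ℕ) : horizon (k + 1) + 1 + i + 1 - horizon (k + 1) - 1 = i + 1 := by omega
  rw [LHat, LBar, e, e, LHat]
  simp (disch := omega) only [if_pos, if_neg]
  ring

theorem LBar_comm (k i j : ℕ) : LBar k i j = LBar k j i := by
  induction k generalizing i j with
  | zero => rfl
  | succ k ih =>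
    cases k with
    | zero => simp only [LBar, and_comm]
    | succ k =>
      rw [LBar, LBar, ih i j, ih (i - horizon (k + 1) - 1) (j - horizon (k + 1) - 1)]
      simp only [mul_comm (cSubPi (k + 2) i) (cSubPi (k + 2) j),
        mul_comm (cSubPi (k + 1) i) (cSubPi (k + 1) j),
        mul_comm (cSubPi (k + 1) (i - horizon (k + 1) - 1)), and_comm]
      ring

theorem LHat_offDiag_nonpos (hi : i < horizon (k + 1)) (hj : j < horizon (k + 1)) (hij : i ≠ j) :
    LHat (k + 1) (i + 1) (j + 1) ≤ 0 := by
  have hr := rho_pos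
  induction k generalizing i j with
  | zero =>
    rw [zero_add, horizon_one] at hi hj
    omega
  | succ k ih =>
    rw [horizon_add_two] at hi hj
    obtain h | rfl | ⟨a, h, rfl⟩ := glue_cases hi <;>
      obtain h' | rfl | ⟨b, h', rfl⟩ := glue_cases hj
    · rw [LHat_left_left k h h']; exact ih h h' hij
    · rw [LHat_left_mid k h, neg_mul, neg_nonpos]
      exact mul_nonneg (by positivity) (cSubPi_nonneg k h)
    · rw [LHat_left_right k h]
    · rw [LHat_mid_left k h', neg_mul, neg_nonpos]
      exact mul_nonneg (by positivity) (cSubPi_nonneg k h')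
    · exact absurd rfl hij
    · rw [LHat_mid_right k h', neg_mul, neg_nonpos]
      exact mul_nonneg hr.le (silverStep_pos _).le
    · rw [LHat_right_left k h']
    · rw [LHat_right_mid k h, neg_mul, neg_nonpos]
      exact mul_nonneg hr.le (silverStep_pos _).le
    · rw [LHat_right_right k h h']
      exact mul_nonpos_of_nonneg_of_nonpos (by positivity) (ih h h' (by omega))

theorem sum_cSubPi :
    ∑ j ∈ Finset.range (horizon (k + 1)), cSubPi (k + 1) (j + 1) = rho ^ (k + 1) - 1 := by
  rw [Finset.sum_congr rfl fun j hj => cSubPi_eq (Finset.mem_range.1 hj), Finset.sum_sub_distrib,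
    sum_cSeq, sum_silverStep]
  ring

theorem sum_LHat_row (hi : i < horizon (k + 1)) :
    ∑ j ∈ Finset.range (horizon (k + 1)), LHat (k + 1) (i + 1) (j + 1)
      = silverStep i + cSubPi (k + 1) (i + 1) * rho ^ (k + 1) := by
  have hr := rho_pos.ne'
  induction k generalizing i with
  | zero =>
    rw [zero_add, horizon_one] at hi ⊢
    obtain rfl : i = 0 := by omega
    have h := cSubPi_eq (k := 1) (j := 0) one_pos
    rw [Finset.sum_range_one, zero_add, LHat_one, h, zero_add, cSeq_one, silverStep_zero]
    linear_combination -rho_sq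
  | succ k ih =>
    have hq : 1 / rho ^ (k + 1) * rho ^ (k + 1) = 1 := by field_simp
    rw [horizon_add_two] at hi ⊢
    rw [sum_range_glue]
    obtain h | rfl | ⟨a, h, rfl⟩ := glue_cases hi
    · rw [Finset.sum_congr rfl fun j hj => LHat_left_left k h (Finset.mem_range.1 hj),
        Finset.sum_congr rfl fun j hj => LHat_left_right k h,
        ih h, LHat_left_mid k h, cSubPi_left k h, Finset.sum_const_zero]
      ring
    · rw [Finset.sum_congr rfl fun j hj => LHat_mid_left k (Finset.mem_range.1 hj),
        Finset.sum_congr rfl fun j hj => LHat_mid_right k (Finset.mem_range.1 hj),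
        LHat_mid_mid, ← Finset.mul_sum, ← Finset.mul_sum, sum_silverStep, sum_cSubPi,
        silverStep_horizon, cSubPi_mid]
      linear_combination (-rho * (rho ^ k + 1)) * hq
    · rw [Finset.sum_congr rfl fun j hj => LHat_right_left k (Finset.mem_range.1 hj),
        Finset.sum_congr rfl fun j hj => LHat_right_right k h (Finset.mem_range.1 hj),
        LHat_right_mid k h, ← Finset.mul_sum, ih h, Finset.sum_const_zero,
        silverStep_shift h, cSubPi_right k h]
      linear_combination silverStep a * rho_sq - silverStep a * rho * hq

theorem sum_LBar_row (hi : i < horizon (k + 1)) :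
    ∑ j ∈ Finset.range (horizon (k + 1)), LBar (k + 1) (i + 1) (j + 1) = cSeq (k + 1) (i + 1) := by
  have h₁ := sum_LHat_row k hi
  simp only [LHat, Finset.sum_add_distrib, ← Finset.mul_sum] at h₁
  rw [sum_cSubPi, cSubPi_eq hi] at h₁
  linear_combination h₁

theorem LBar_offDiag_nonpos (hi : i < horizon (k + 1)) (hj : j < horizon (k + 1)) (hij : i ≠ j) :
    LBar (k + 1) (i + 1) (j + 1) ≤ 0 := by
  have h := LHat_offDiag_nonpos k hi hj hij
  have := mul_nonneg (cSubPi_nonneg k hi) (cSubPi_nonneg k hj)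
  rw [LHat] at h
  linarith

/-- A symmetric matrix with nonpositive off-diagonal entries dominates the diagonal matrix of its
row sums: the difference is a weighted graph Laplacian. -/
theorem sum_rowSum_mul_sq_le {ι : Type*} (s : Finset ι) (A : ι → ι → ℝ)
    (hA : ∀ i j, A i j = A j i) (hA' : ∀ i ∈ s, ∀ j ∈ s, i ≠ j → A i j ≤ 0) (y : ι → ℝ) :
    ∑ i ∈ s, (∑ j ∈ s, A i j) * y i ^ 2 ≤ ∑ i ∈ s, ∑ j ∈ s, A i j * (y i * y j) := by
  have h₁ : ∑ i ∈ s, ∑ j ∈ s, A i j * (y i - y j) ^ 2 ≤ 0 := by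
    refine Finset.sum_nonpos fun i hi => Finset.sum_nonpos fun j hj => ?_
    obtain rfl | hij := eq_or_ne i j
    · simp
    · exact mul_nonpos_of_nonpos_of_nonneg (hA' i hi j hj hij) (sq_nonneg _)
  have h₂ : ∑ i ∈ s, ∑ j ∈ s, A i j * y j ^ 2 = ∑ i ∈ s, (∑ j ∈ s, A i j) * y i ^ 2 := by
    rw [Finset.sum_comm]
    simp only [Finset.sum_mul, fun i j => hA j i]
  have h₃ : ∑ i ∈ s, ∑ j ∈ s, A i j * (y i - y j) ^ 2
      = ∑ i ∈ s, (∑ j ∈ s, A i j) * y i ^ 2 + ∑ i ∈ s, ∑ j ∈ s, A i j * y j ^ 2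
        - 2 * ∑ i ∈ s, ∑ j ∈ s, A i j * (y i * y j) := by
    simp only [Finset.sum_mul, Finset.mul_sum, ← Finset.sum_add_distrib, ← Finset.sum_sub_distrib]
    exact Finset.sum_congr rfl fun i _ => Finset.sum_congr rfl fun j _ => by ring
  linarith

/-- The value of the bilinear form of the slack matrix, with its border separated from `L̄`. -/
theorem sum_slack_mul (B : ℕ → ℕ → ℝ) (hB : ∀ i j, B i j = B j i) :
    ∑ a, ∑ b, slack (k + 1) a b * B a b
      = 1 / Real.sqrt 2 * B 0 0 + 2 * (B 0 (horizon (k + 1) + 1) - B 0 1)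
        + ∑ i ∈ Finset.range (horizon (k + 1)), ∑ j ∈ Finset.range (horizon (k + 1)),
            LBar (k + 1) (i + 1) (j + 1) * B (i + 1) (j + 1)
        - 2 * ∑ i ∈ Finset.range (horizon (k + 1)),
            cSeq (k + 1) (i + 1) * B (i + 1) (horizon (k + 1) + 1)
        + 2 * (rho ^ (k + 1) - 1) * B (horizon (k + 1) + 1) (horizon (k + 1) + 1) := by
  set n := horizon (k + 1) with hn
  have hn₁ : 1 ≤ n := horizon_succ_pos k
  let T : ℕ → ℕ → ℝ := fun i j =>
    (if i = 0 then if j = 0 then 1 / Real.sqrt 2 else eVec (k + 1) j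
      else if j = 0 then eVec (k + 1) i else LEntry (k + 1) i j) * B i j
  have hT : ∑ a, ∑ b, slack (k + 1) a b * B a b
      = ∑ i ∈ Finset.range (n + 2), ∑ j ∈ Finset.range (n + 2), T i j := by
    simp only [← Fin.sum_univ_eq_sum_range]
    rfl
  have he : ∑ j ∈ Finset.range (n + 1), eVec (k + 1) (j + 1) * B 0 (j + 1)
      = B 0 (n + 1) - B 0 1 := by
    simp only [eVec, add_mul, Finset.sum_add_distrib, neg_mul, ite_mul, one_mul, zero_mul,
      Finset.sum_neg_distrib, Nat.add_eq_right, Nat.add_right_cancel_iff, ← hn]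
    rw [Finset.sum_ite_eq', Finset.sum_ite_eq', if_pos (by simp), if_pos (by simp)]
    ring
  have he' : ∑ j ∈ Finset.range (n + 1), eVec (k + 1) (j + 1) * B (j + 1) 0
      = B 0 (n + 1) - B 0 1 :=
    (Finset.sum_congr rfl fun j _ => by rw [hB]).trans he
  have hL : ∀ i < n, ∀ j < n, LEntry (k + 1) (i + 1) (j + 1) = LBar (k + 1) (i + 1) (j + 1) :=
    fun i hi j hj => by rw [LEntry, if_pos (by omega), if_pos (by omega)]
  have hL₁ : ∀ i < n, LEntry (k + 1) (i + 1) (n + 1) = -cSeq (k + 1) (i + 1) :=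
    fun i hi => by rw [LEntry, if_pos (by omega), if_neg (by omega)]
  have hL₂ : ∀ j < n, LEntry (k + 1) (n + 1) (j + 1) = -cSeq (k + 1) (j + 1) :=
    fun i hi => by rw [LEntry, if_neg (by omega), if_pos (by omega)]
  have hL₃ : LEntry (k + 1) (n + 1) (n + 1) = 2 * (rho ^ (k + 1) - 1) := by
    rw [LEntry, if_neg (by omega), if_neg (by omega)]
  have hLs : ∑ i ∈ Finset.range (n + 1), ∑ j ∈ Finset.range (n + 1),
      LEntry (k + 1) (i + 1) (j + 1) * B (i + 1) (j + 1)
      = ∑ i ∈ Finset.range n, ∑ j ∈ Finset.range n,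
          LBar (k + 1) (i + 1) (j + 1) * B (i + 1) (j + 1)
        - 2 * ∑ i ∈ Finset.range n, cSeq (k + 1) (i + 1) * B (i + 1) (n + 1)
        + 2 * (rho ^ (k + 1) - 1) * B (n + 1) (n + 1) := by
    have h₁ : ∑ i ∈ Finset.range n, ∑ j ∈ Finset.range n,
        LEntry (k + 1) (i + 1) (j + 1) * B (i + 1) (j + 1)
        = ∑ i ∈ Finset.range n, ∑ j ∈ Finset.range n,
          LBar (k + 1) (i + 1) (j + 1) * B (i + 1) (j + 1) :=
      Finset.sum_congr rfl fun i hi => Finset.sum_congr rfl fun j hj => by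
        rw [hL i (Finset.mem_range.1 hi) j (Finset.mem_range.1 hj)]
    have h₂ : ∑ i ∈ Finset.range n, LEntry (k + 1) (i + 1) (n + 1) * B (i + 1) (n + 1)
        = ∑ i ∈ Finset.range n, -(cSeq (k + 1) (i + 1) * B (i + 1) (n + 1)) :=
      Finset.sum_congr rfl fun i hi => by rw [hL₁ i (Finset.mem_range.1 hi), neg_mul]
    have h₃ : ∑ j ∈ Finset.range n, LEntry (k + 1) (n + 1) (j + 1) * B (n + 1) (j + 1)
        = ∑ j ∈ Finset.range n, -(cSeq (k + 1) (j + 1) * B (j + 1) (n + 1)) :=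
      Finset.sum_congr rfl fun j hj => by
        rw [hL₂ j (Finset.mem_range.1 hj), hB (n + 1), neg_mul]
    simp only [Finset.sum_range_succ, Finset.sum_add_distrib, hL₃, h₁, h₂, h₃,
      Finset.sum_neg_distrib]
    ring
  rw [hT, Finset.sum_range_succ']
  simp only [Finset.sum_range_succ' _ (n + 1), T, Finset.sum_add_distrib, if_true,
    Nat.add_eq_zero_iff, one_ne_zero, and_false, if_false]
  rw [hLs, he, he']
  ring

theorem slack_posSemidef : (slack (k + 1)).PosSemidef := by
  refine .of_dotProduct_mulVec_nonneg ?_ fun v => ?_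
  · ext a b
    simp only [slack, Matrix.conjTranspose_apply, Matrix.of_apply, star_trivial, LEntry]
    split_ifs <;> first | rfl | exact LBar_comm _ _ _
  let y : ℕ → ℝ := fun i => if h : i < horizon (k + 1) + 2 then v ⟨i, h⟩ else 0
  have hy (a : Fin (horizon (k + 1) + 2)) : v a = y a := by simp [y]
  have hquad : star v ⬝ᵥ (slack (k + 1)).mulVec v = ∑ a, ∑ b, slack (k + 1) a b * (y a * y b) := by
    simp only [dotProduct, Matrix.mulVec, Finset.mul_sum, star_trivial]
    exact Finset.sum_congr rfl fun a _ => Finset.sum_congr rfl fun b _ => by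
      rw [hy a, hy b]; ring
  rw [hquad, sum_slack_mul k (fun i j => y i * y j) (fun i j => mul_comm _ _)]
  have h₁ := sum_rowSum_mul_sq_le (Finset.range (horizon (k + 1)))
    (fun i j => LBar (k + 1) (i + 1) (j + 1))
    (fun i j => LBar_comm _ _ _)
    (fun i hi j hj => LBar_offDiag_nonpos k (Finset.mem_range.1 hi) (Finset.mem_range.1 hj))
    (fun i => y (i + 1))
  rw [Finset.sum_congr rfl fun i hi => by rw [sum_LBar_row k (Finset.mem_range.1 hi)]] at h₁
  have hnonneg : ∀ i ∈ Finset.range (horizon (k + 1)),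
      0 ≤ cSeq (k + 1) (i + 1) * (y (i + 1) - y (horizon (k + 1) + 1)) ^ 2 :=
    fun i hi => mul_nonneg
      ((silverStep_pos i).le.trans (silverStep_le_cSeq k (Finset.mem_range.1 hi))) (sq_nonneg _)
  have h₂ := Finset.single_le_sum hnonneg (Finset.mem_range.2 (horizon_succ_pos k))
  have h₃ := mul_le_mul_of_nonneg_right (silverStep_le_cSeq k (horizon_succ_pos k))
    (sq_nonneg (y 1 - y (horizon (k + 1) + 1)))
  have h₄ : ∑ i ∈ Finset.range (horizon (k + 1)),
        cSeq (k + 1) (i + 1) * (y (i + 1) - y (horizon (k + 1) + 1)) ^ 2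
      = ∑ i ∈ Finset.range (horizon (k + 1)), cSeq (k + 1) (i + 1) * y (i + 1) ^ 2
        - 2 * ∑ i ∈ Finset.range (horizon (k + 1)),
            cSeq (k + 1) (i + 1) * (y (i + 1) * y (horizon (k + 1) + 1))
        + 2 * (rho ^ (k + 1) - 1) * y (horizon (k + 1) + 1) ^ 2 := by
    rw [← sum_cSeq k, Finset.mul_sum, Finset.sum_mul, ← Finset.sum_sub_distrib,
      ← Finset.sum_add_distrib]
    exact Finset.sum_congr rfl fun i _ => by ring
  rw [silverStep_zero, ← sqrt_two_eq] at h₃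
  have h2 : Real.sqrt 2 ^ 2 = 2 := Real.sq_sqrt (by norm_num)
  have hs : 0 < Real.sqrt 2 := Real.sqrt_pos.2 (by norm_num)
  -- completing the square in the coordinate with index `0`
  have h₅ : 0 ≤ 1 / Real.sqrt 2 * (y 0 + Real.sqrt 2 * (y (horizon (k + 1) + 1) - y 1)) ^ 2 := by
    positivity
  have h₆ : 1 / Real.sqrt 2 * (y 0 + Real.sqrt 2 * (y (horizon (k + 1) + 1) - y 1)) ^ 2
      = 1 / Real.sqrt 2 * (y 0 * y 0) + 2 * (y 0 * y (horizon (k + 1) + 1) - y 0 * y 1)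
        + Real.sqrt 2 * (y 1 - y (horizon (k + 1) + 1)) ^ 2 := by
    field_simp
    ring
  simp only [zero_add] at h₂ h₃
  linarith

end SilverProx

/-! ### Sums against the multipliers at level `k + 1` -/

namespace SilverProx

variable (k : ℕ)

/-- A sum against `λ̄` at level `k + 1` through sums at level `k`. The index `n + 1 + n` is the last
one, `2n + 1`. -/
theorem sum_lamBar_succ (Q : ℕ → ℕ → ℝ) :
    ∑ i ∈ Finset.range (horizon (k + 2) + 1), ∑ j ∈ Finset.range (horizon (k + 2) + 1),
        lamBar (k + 2) i j * Q i j
      = ∑ i ∈ Finset.range (horizon (k + 1) + 1), ∑ j ∈ Finset.range (horizon (k + 1) + 1),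
          lamBar (k + 1) i j * Q i j
        + rho ^ 2 * ∑ i ∈ Finset.range (horizon (k + 1) + 1),
            ∑ j ∈ Finset.range (horizon (k + 1) + 1),
              lamBar (k + 1) i j * Q (horizon (k + 1) + 1 + i) (horizon (k + 1) + 1 + j)
        + rho * Q (horizon (k + 1)) (horizon (k + 1) + 1 + horizon (k + 1))
        + rho ^ (k + 1) * Q (horizon (k + 1) + 1 + horizon (k + 1)) (horizon (k + 1))
        + rho * ∑ t ∈ Finset.range (horizon (k + 1)),
            silverStep t * Q (horizon (k + 1)) (horizon (k + 1) + 1 + t)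
        + rho * ∑ t ∈ Finset.range (horizon (k + 1)),
            silverStep t * Q (horizon (k + 1) + 1 + horizon (k + 1)) (horizon (k + 1) + 1 + t) := by
  rw [horizon_add_two]
  have hA := fun i (hi : i < horizon (k + 1) + 1) j hj => @lamBar_left_left k i j hi hj
  have hB := fun i (hi : i < horizon (k + 1) + 1) j hj => @lamBar_left_right k i j hi hj
  have hC := fun i j hj => @lamBar_right_left k i j hj
  have hD := fun i (hi : i < horizon (k + 1) + 1) j hj => @lamBar_right_right k i j hi hj
  generalize horizon (k + 1) = n at *
  rw [show 2 * n + 1 + 1 = n + 1 + (n + 1) by ring]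
  have e₁ : ∑ i ∈ Finset.range (n + 1), ∑ j ∈ Finset.range (n + 1), lamBar (k + 2) i j * Q i j
      = ∑ i ∈ Finset.range (n + 1), ∑ j ∈ Finset.range (n + 1), lamBar (k + 1) i j * Q i j :=
    Finset.sum_congr rfl fun i hi => Finset.sum_congr rfl fun j hj => by
      rw [hA i (Finset.mem_range.1 hi) j (Finset.mem_range.1 hj)]
  have hlast (c : ℝ) (F W : ℕ → ℝ) :
      ∑ j ∈ Finset.range (n + 1), (if j = n then c else W j) * F j
        = ∑ j ∈ Finset.range n, W j * F j + c * F n := by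
    rw [Finset.sum_range_succ, if_pos rfl]
    refine congrArg (· + _) (Finset.sum_congr rfl fun j hj => ?_)
    rw [if_neg (Finset.mem_range.1 hj).ne]
  have hrow (F W : ℕ → ℕ → ℝ) :
      ∑ i ∈ Finset.range (n + 1), ∑ j ∈ Finset.range (n + 1), (if i = n then W i j else 0) * F i j
        = ∑ j ∈ Finset.range (n + 1), W n j * F n j := by
    rw [Finset.sum_range_succ, Finset.sum_eq_zero, zero_add]
    · simp
    · intro i hi
      simp [(Finset.mem_range.1 hi).ne]
  have e₂ : ∑ i ∈ Finset.range (n + 1), ∑ j ∈ Finset.range (n + 1),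
        lamBar (k + 2) i (n + 1 + j) * Q i (n + 1 + j)
      = rho * ∑ t ∈ Finset.range n, silverStep t * Q n (n + 1 + t) + rho * Q n (n + 1 + n) := by
    rw [Finset.sum_congr rfl fun i hi => Finset.sum_congr rfl fun j hj => by
      rw [hB i (Finset.mem_range.1 hi) j (Finset.mem_range.1 hj)], hrow]
    simp only [mul_assoc, ← Finset.mul_sum]
    rw [hlast]
    ring
  have e₃ : ∑ i ∈ Finset.range (n + 1), ∑ j ∈ Finset.range (n + 1),
        lamBar (k + 2) (n + 1 + i) j * Q (n + 1 + i) j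
      = rho ^ (k + 1) * Q (n + 1 + n) n := by
    rw [Finset.sum_congr rfl fun i hi => Finset.sum_congr rfl fun j hj => by
      rw [hC i j (Finset.mem_range.1 hj)], hrow, hlast]
    simp
  have e₄ : ∑ i ∈ Finset.range (n + 1), ∑ j ∈ Finset.range (n + 1),
        lamBar (k + 2) (n + 1 + i) (n + 1 + j) * Q (n + 1 + i) (n + 1 + j)
      = rho ^ 2 * ∑ i ∈ Finset.range (n + 1), ∑ j ∈ Finset.range (n + 1),
          lamBar (k + 1) i j * Q (n + 1 + i) (n + 1 + j)
        + rho * ∑ t ∈ Finset.range n, silverStep t * Q (n + 1 + n) (n + 1 + t) := by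
    rw [Finset.sum_congr rfl fun i hi => Finset.sum_congr rfl fun j hj => by
      rw [hD i (Finset.mem_range.1 hi) j (Finset.mem_range.1 hj), add_mul, mul_assoc]]
    simp only [Finset.sum_add_distrib, ← Finset.mul_sum]
    rw [hrow]
    simp only [mul_assoc, ← Finset.mul_sum]
    rw [hlast]
    ring
  rw [Finset.sum_range_add]
  simp only [Finset.sum_range_add _ (n + 1) (n + 1), Finset.sum_add_distrib]
  rw [e₁, e₂, e₃, e₄]
  ring

/-- A sum against `μ̄` at level `k + 1` through sums at level `k`. The index `n + 1 + n` is the last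
one, `2n + 1`. -/
theorem sum_muBar_succ (Q : ℕ → ℕ → ℝ) :
    ∑ i ∈ Finset.range (horizon (k + 2)), ∑ j ∈ Finset.range (horizon (k + 2)),
        muBar (k + 2) (i + 1) (j + 1) * Q (i + 1) (j + 1)
      = ∑ i ∈ Finset.range (horizon (k + 1)), ∑ j ∈ Finset.range (horizon (k + 1)),
          muBar (k + 1) (i + 1) (j + 1) * Q (i + 1) (j + 1)
        + rho ^ 2 * ∑ i ∈ Finset.range (horizon (k + 1)), ∑ j ∈ Finset.range (horizon (k + 1)),
            muBar (k + 1) (i + 1) (j + 1)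
              * Q (horizon (k + 1) + 1 + (i + 1)) (horizon (k + 1) + 1 + (j + 1))
        + rho ^ (k + 1) * Q (horizon (k + 1)) (horizon (k + 1) + 1)
        + rho ^ 2 * Q (horizon (k + 1) + 1) (horizon (k + 1) + 1 + 1)
        + (rho - 1 / rho ^ (k + 1)) * (rho ^ k + 1)
            * Q (horizon (k + 1) + 1 + horizon (k + 1)) (horizon (k + 1) + 1)
        + (1 - rho ^ (k + 1) / (rho ^ k + 1)) * ∑ j ∈ Finset.range (horizon (k + 1)),
            cSubPi (k + 1) (j + 1) * Q (horizon (k + 1)) (j + 1)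
        + rho ^ (k + 1) / (rho ^ k + 1) * ∑ j ∈ Finset.range (horizon (k + 1)),
            cSubPi (k + 1) (j + 1) * Q (horizon (k + 1) + 1) (j + 1)
        + rho ^ (k + 1) / (rho ^ k + 1) * ∑ j ∈ Finset.range (horizon (k + 1)),
            silverStep j * Q (horizon (k + 1)) (horizon (k + 1) + 1 + (j + 1))
        + rho / (rho ^ k + 1) * ∑ j ∈ Finset.range (horizon (k + 1)),
            silverStep j * Q (horizon (k + 1) + 1) (horizon (k + 1) + 1 + (j + 1))
        + (rho + 1) * ∑ j ∈ Finset.range (horizon (k + 1)), cSubPi (k + 1) (j + 1)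
            * Q (horizon (k + 1) + 1 + horizon (k + 1)) (horizon (k + 1) + 1 + (j + 1))
        + (rho - 1 / rho ^ (k + 1)) * ∑ j ∈ Finset.range (horizon (k + 1)), silverStep j
            * Q (horizon (k + 1) + 1 + horizon (k + 1)) (horizon (k + 1) + 1 + (j + 1)) := by
  have hAA := fun i (hi : i < horizon (k + 1)) j hj => @muBar_left_left k i j hi hj
  have hAM := fun i (hi : i < horizon (k + 1)) => @muBar_left_mid k i hi
  have hAC := fun i (hi : i < horizon (k + 1)) j hj => @muBar_left_right k i j hi hj
  have hMA := fun j (hj : j < horizon (k + 1)) => @muBar_mid_left k j hj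
  have hMM := muBar_mid_mid k
  have hMC := fun j (hj : j < horizon (k + 1)) => @muBar_mid_right k j hj
  have hCA := fun i j (hj : j < horizon (k + 1)) => @muBar_right_left k i j hj
  have hCM := fun i => @muBar_right_mid k i
  have hCC := fun i (hi : i < horizon (k + 1)) j hj => @muBar_right_right k i j hi hj
  have hpos := horizon_succ_pos k
  rw [horizon_add_two]
  generalize horizon (k + 1) = n at *
  obtain ⟨m, rfl⟩ : ∃ m, n = m + 1 := ⟨n - 1, by omega⟩
  have hrow (W : ℝ) (F : ℕ → ℝ) :
      ∑ i ∈ Finset.range (m + 1), (if i + 1 = m + 1 then W else 0) * F i = W * F m := by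
    simp [ite_mul]
  have hrow₂ (W : ℕ → ℝ) (F : ℕ → ℕ → ℝ) :
      ∑ i ∈ Finset.range (m + 1), ∑ j ∈ Finset.range (m + 1),
        (if i + 1 = m + 1 then W j else 0) * F i j = ∑ j ∈ Finset.range (m + 1), W j * F m j := by
    rw [Finset.sum_comm]
    exact Finset.sum_congr rfl fun j _ => hrow (W j) fun i => F i j
  have eAA : ∑ i ∈ Finset.range (m + 1), ∑ j ∈ Finset.range (m + 1),
      muBar (k + 2) (i + 1) (j + 1) * Q (i + 1) (j + 1)
      = ∑ i ∈ Finset.range (m + 1), ∑ j ∈ Finset.range (m + 1),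
          muBar (k + 1) (i + 1) (j + 1) * Q (i + 1) (j + 1)
        + (1 - rho ^ (k + 1) / (rho ^ k + 1)) * ∑ j ∈ Finset.range (m + 1),
            cSubPi (k + 1) (j + 1) * Q (m + 1) (j + 1) := by
    rw [Finset.sum_congr rfl fun i hi => Finset.sum_congr rfl fun j hj => by
      rw [hAA i (Finset.mem_range.1 hi) j (Finset.mem_range.1 hj), add_mul]]
    simp only [Finset.sum_add_distrib]
    rw [hrow₂]
    simp only [mul_assoc, ← Finset.mul_sum]
  have eAM : ∑ i ∈ Finset.range (m + 1), muBar (k + 2) (i + 1) (m + 1 + 1) * Q (i + 1) (m + 1 + 1)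
      = rho ^ (k + 1) * Q (m + 1) (m + 1 + 1) := by
    rw [Finset.sum_congr rfl fun i hi => by rw [hAM i (Finset.mem_range.1 hi)], hrow]
  have eAC : ∑ i ∈ Finset.range (m + 1), ∑ j ∈ Finset.range (m + 1),
      muBar (k + 2) (i + 1) (m + 1 + 1 + j + 1) * Q (i + 1) (m + 1 + 1 + j + 1)
      = rho ^ (k + 1) / (rho ^ k + 1) * ∑ j ∈ Finset.range (m + 1),
          silverStep j * Q (m + 1) (m + 1 + 1 + j + 1) := by
    rw [Finset.sum_congr rfl fun i hi => Finset.sum_congr rfl fun j hj => by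
      rw [hAC i (Finset.mem_range.1 hi) j (Finset.mem_range.1 hj)], hrow₂]
    simp only [mul_assoc, ← Finset.mul_sum]
  have eMA : ∑ j ∈ Finset.range (m + 1), muBar (k + 2) (m + 1 + 1) (j + 1) * Q (m + 1 + 1) (j + 1)
      = rho ^ (k + 1) / (rho ^ k + 1) * ∑ j ∈ Finset.range (m + 1),
          cSubPi (k + 1) (j + 1) * Q (m + 1 + 1) (j + 1) := by
    rw [Finset.sum_congr rfl fun j hj => by rw [hMA j (Finset.mem_range.1 hj)]]
    simp only [mul_assoc, ← Finset.mul_sum]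
  have eMC : ∑ j ∈ Finset.range (m + 1),
      muBar (k + 2) (m + 1 + 1) (m + 1 + 1 + j + 1) * Q (m + 1 + 1) (m + 1 + 1 + j + 1)
      = rho ^ 2 * Q (m + 1 + 1) (m + 1 + 1 + 1)
        + rho / (rho ^ k + 1) * ∑ j ∈ Finset.range (m + 1),
          silverStep j * Q (m + 1 + 1) (m + 1 + 1 + j + 1) := by
    rw [Finset.sum_congr rfl fun j hj => by rw [hMC j (Finset.mem_range.1 hj), add_mul]]
    simp only [Finset.sum_add_distrib, ite_mul, zero_mul, mul_assoc, ← Finset.mul_sum]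
    rw [Finset.sum_ite_eq', if_pos (by simp)]
  have eCA : ∑ i ∈ Finset.range (m + 1), ∑ j ∈ Finset.range (m + 1),
      muBar (k + 2) (m + 1 + 1 + i + 1) (j + 1) * Q (m + 1 + 1 + i + 1) (j + 1) = 0 :=
    Finset.sum_eq_zero fun i _ => Finset.sum_eq_zero fun j hj => by
      rw [hCA i j (Finset.mem_range.1 hj), zero_mul]
  have eCM : ∑ i ∈ Finset.range (m + 1),
      muBar (k + 2) (m + 1 + 1 + i + 1) (m + 1 + 1) * Q (m + 1 + 1 + i + 1) (m + 1 + 1)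
      = (rho - 1 / rho ^ (k + 1)) * (rho ^ k + 1) * Q (m + 1 + 1 + m + 1) (m + 1 + 1) := by
    rw [Finset.sum_congr rfl fun i _ => by rw [hCM i], hrow]
  have eCC : ∑ i ∈ Finset.range (m + 1), ∑ j ∈ Finset.range (m + 1),
      muBar (k + 2) (m + 1 + 1 + i + 1) (m + 1 + 1 + j + 1)
        * Q (m + 1 + 1 + i + 1) (m + 1 + 1 + j + 1)
      = rho ^ 2 * ∑ i ∈ Finset.range (m + 1), ∑ j ∈ Finset.range (m + 1),
          muBar (k + 1) (i + 1) (j + 1) * Q (m + 1 + 1 + i + 1) (m + 1 + 1 + j + 1)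
        + (rho + 1) * ∑ j ∈ Finset.range (m + 1),
            cSubPi (k + 1) (j + 1) * Q (m + 1 + 1 + m + 1) (m + 1 + 1 + j + 1)
        + (rho - 1 / rho ^ (k + 1)) * ∑ j ∈ Finset.range (m + 1),
            silverStep j * Q (m + 1 + 1 + m + 1) (m + 1 + 1 + j + 1) := by
    rw [Finset.sum_congr rfl fun i hi => Finset.sum_congr rfl fun j hj => by
      rw [hCC i (Finset.mem_range.1 hi) j (Finset.mem_range.1 hj), add_mul, mul_assoc]]
    simp only [Finset.sum_add_distrib, ← Finset.mul_sum]
    rw [hrow₂]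
    simp only [add_mul, mul_assoc, Finset.sum_add_distrib, ← Finset.mul_sum]
    ring
  rw [sum_range_glue]
  simp only [sum_range_glue (m + 1), Finset.sum_add_distrib]
  rw [eAA, eAM, eAC, eMA, hMM, eMC, eCA, eCM, eCC]
  simp only [add_assoc]
  ring

theorem sum_LHat_succ (B : ℕ → ℕ → ℝ) (hB : ∀ i j, B i j = B j i) :
    ∑ i ∈ Finset.range (horizon (k + 2)), ∑ j ∈ Finset.range (horizon (k + 2)),
        LHat (k + 2) (i + 1) (j + 1) * B (i + 1) (j + 1)
      = ∑ i ∈ Finset.range (horizon (k + 1)), ∑ j ∈ Finset.range (horizon (k + 1)),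
          LHat (k + 1) (i + 1) (j + 1) * B (i + 1) (j + 1)
        + rho ^ 2 * ∑ i ∈ Finset.range (horizon (k + 1)), ∑ j ∈ Finset.range (horizon (k + 1)),
            LHat (k + 1) (i + 1) (j + 1)
              * B (horizon (k + 1) + 1 + (i + 1)) (horizon (k + 1) + 1 + (j + 1))
        - 2 * rho ^ (k + 1) * ∑ j ∈ Finset.range (horizon (k + 1)),
            cSubPi (k + 1) (j + 1) * B (horizon (k + 1) + 1) (j + 1)
        + (rho ^ k + 1) * (rho ^ (k + 2) + 1) * B (horizon (k + 1) + 1) (horizon (k + 1) + 1)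
        - 2 * rho * ∑ j ∈ Finset.range (horizon (k + 1)),
            silverStep j * B (horizon (k + 1) + 1) (horizon (k + 1) + 1 + (j + 1)) := by
  have hAA := fun i (hi : i < horizon (k + 1)) j hj => @LHat_left_left k i j hi hj
  have hAM := fun i (hi : i < horizon (k + 1)) => @LHat_left_mid k i hi
  have hAC := fun i (hi : i < horizon (k + 1)) j => @LHat_left_right k i j hi
  have hMA := fun j (hj : j < horizon (k + 1)) => @LHat_mid_left k j hj
  have hMM := LHat_mid_mid k
  have hMC := fun j (hj : j < horizon (k + 1)) => @LHat_mid_right k j hj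
  have hCA := fun i j (hj : j < horizon (k + 1)) => @LHat_right_left k i j hj
  have hCM := fun i (hi : i < horizon (k + 1)) => @LHat_right_mid k i hi
  have hCC := fun i (hi : i < horizon (k + 1)) j hj => @LHat_right_right k i j hi hj
  rw [horizon_add_two]
  generalize horizon (k + 1) = n at *
  have eAA : ∑ i ∈ Finset.range n, ∑ j ∈ Finset.range n,
      LHat (k + 2) (i + 1) (j + 1) * B (i + 1) (j + 1)
      = ∑ i ∈ Finset.range n, ∑ j ∈ Finset.range n,
          LHat (k + 1) (i + 1) (j + 1) * B (i + 1) (j + 1) :=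
    Finset.sum_congr rfl fun i hi => Finset.sum_congr rfl fun j hj => by
      rw [hAA i (Finset.mem_range.1 hi) j (Finset.mem_range.1 hj)]
  have eAM : ∑ i ∈ Finset.range n, LHat (k + 2) (i + 1) (n + 1) * B (i + 1) (n + 1)
      = -rho ^ (k + 1) * ∑ i ∈ Finset.range n, cSubPi (k + 1) (i + 1) * B (n + 1) (i + 1) := by
    rw [Finset.mul_sum]
    exact Finset.sum_congr rfl fun i hi => by
      rw [hAM i (Finset.mem_range.1 hi), hB, mul_assoc]
  have eAC : ∑ i ∈ Finset.range n, ∑ j ∈ Finset.range n,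
      LHat (k + 2) (i + 1) (n + 1 + j + 1) * B (i + 1) (n + 1 + j + 1) = 0 :=
    Finset.sum_eq_zero fun i hi => Finset.sum_eq_zero fun j _ => by
      rw [hAC i (Finset.mem_range.1 hi), zero_mul]
  have eMA : ∑ j ∈ Finset.range n, LHat (k + 2) (n + 1) (j + 1) * B (n + 1) (j + 1)
      = -rho ^ (k + 1) * ∑ j ∈ Finset.range n, cSubPi (k + 1) (j + 1) * B (n + 1) (j + 1) := by
    rw [Finset.mul_sum]
    exact Finset.sum_congr rfl fun j hj => by rw [hMA j (Finset.mem_range.1 hj), mul_assoc]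
  have eMC : ∑ j ∈ Finset.range n, LHat (k + 2) (n + 1) (n + 1 + j + 1) * B (n + 1) (n + 1 + j + 1)
      = -rho * ∑ j ∈ Finset.range n, silverStep j * B (n + 1) (n + 1 + j + 1) := by
    rw [Finset.mul_sum]
    exact Finset.sum_congr rfl fun j hj => by rw [hMC j (Finset.mem_range.1 hj), mul_assoc]
  have eCA : ∑ i ∈ Finset.range n, ∑ j ∈ Finset.range n,
      LHat (k + 2) (n + 1 + i + 1) (j + 1) * B (n + 1 + i + 1) (j + 1) = 0 :=
    Finset.sum_eq_zero fun i _ => Finset.sum_eq_zero fun j hj => by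
      rw [hCA i j (Finset.mem_range.1 hj), zero_mul]
  have eCM : ∑ i ∈ Finset.range n, LHat (k + 2) (n + 1 + i + 1) (n + 1) * B (n + 1 + i + 1) (n + 1)
      = -rho * ∑ i ∈ Finset.range n, silverStep i * B (n + 1) (n + 1 + i + 1) := by
    rw [Finset.mul_sum]
    exact Finset.sum_congr rfl fun i hi => by
      rw [hCM i (Finset.mem_range.1 hi), hB, mul_assoc]
  have eCC : ∑ i ∈ Finset.range n, ∑ j ∈ Finset.range n,
      LHat (k + 2) (n + 1 + i + 1) (n + 1 + j + 1) * B (n + 1 + i + 1) (n + 1 + j + 1)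
      = rho ^ 2 * ∑ i ∈ Finset.range n, ∑ j ∈ Finset.range n,
          LHat (k + 1) (i + 1) (j + 1) * B (n + 1 + i + 1) (n + 1 + j + 1) := by
    simp only [Finset.mul_sum]
    exact Finset.sum_congr rfl fun i hi => Finset.sum_congr rfl fun j hj => by
      rw [hCC i (Finset.mem_range.1 hi) j (Finset.mem_range.1 hj), mul_assoc]
  rw [sum_range_glue]
  simp only [sum_range_glue n, Finset.sum_add_distrib]
  rw [eAA, eAM, eAC, eMA, hMM, eMC, eCA, eCM, eCC]
  simp only [add_assoc]
  ring

end SilverProx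

/-! ### The descent identity without the minimizer -/

namespace SilverProx

variable {E ι : Type*} [NormedAddCommGroup E] [InnerProductSpace ℝ E]

/-- The co-coercivity `f_i - f_j - ⟨g_j, x_i - x_j⟩ - ½ ‖g_i - g_j‖²` of an abstract family of
function values, points and gradients, with no function behind them. -/
noncomputable def coco (f : ι → ℝ) (x g : ι → E) (i j : ι) : ℝ :=
  f i - f j - inner ℝ (g j) (x i - x j) - 1 / 2 * ‖g i - g j‖ ^ 2

/-- The linearization gap `h_i - h_j - ⟨s_j, x_i - x_j⟩` of an abstract family of function values,
points and subgradients, with no function behind them. -/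
noncomputable def linGap (h : ι → ℝ) (x s : ι → E) (i j : ι) : ℝ :=
  h i - h j - inner ℝ (s j) (x i - x j)

/-- A weighted sum of co-coercivities with a common first index. Besides the data of that index it
involves only the weighted sum of the `g`'s and one scalar, in which the points enter relative to an
arbitrary base point `y`. -/
theorem sum_mul_coco (w : ℕ → ℝ) (n : ℕ) (e : ℕ → ι) (f : ι → ℝ) (x g : ι → E) (i : ι) (y : E) :
    ∑ t ∈ Finset.range n, w t * coco f x g i (e t)
      = (∑ t ∈ Finset.range n, w t) * (f i - 1 / 2 * ‖g i‖ ^ 2)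
        - ∑ t ∈ Finset.range n, w t * (f (e t) + 1 / 2 * ‖g (e t)‖ ^ 2
            + inner ℝ (g (e t)) (y - x (e t)))
        + inner ℝ (g i + y - x i) (∑ t ∈ Finset.range n, w t • g (e t)) := by
  simp only [inner_sum, Finset.sum_mul, ← Finset.sum_sub_distrib, ← Finset.sum_add_distrib]
  refine Finset.sum_congr rfl fun t _ => ?_
  simp only [coco, norm_sub_sq_real, inner_smul_right, inner_add_left, inner_sub_left,
    inner_sub_right, real_inner_comm]
  ring

/-- The analogue of `sum_mul_coco` for linearization gaps. -/
theorem sum_mul_linGap (w : ℕ → ℝ) (n : ℕ) (e : ℕ → ι) (h : ι → ℝ) (x s : ι → E) (i : ι) (y : E) :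
    ∑ t ∈ Finset.range n, w t * linGap h x s i (e t)
      = (∑ t ∈ Finset.range n, w t) * h i
        - ∑ t ∈ Finset.range n, w t * (h (e t) + inner ℝ (s (e t)) (y - x (e t)))
        + inner ℝ (y - x i) (∑ t ∈ Finset.range n, w t • s (e t)) := by
  simp only [inner_sum, Finset.sum_mul, ← Finset.sum_sub_distrib, ← Finset.sum_add_distrib]
  refine Finset.sum_congr rfl fun t _ => ?_
  simp only [linGap, inner_smul_right, inner_sub_left, inner_sub_right, real_inner_comm]
  ring

/-- Change of the base point in the scalars of `sum_mul_coco` and `sum_mul_linGap`. -/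
theorem sum_mul_add_inner_rebase (w : ℕ → ℝ) (n : ℕ) (a : ℕ → ℝ) (v x : ℕ → E) (y z : E) :
    ∑ t ∈ Finset.range n, w t * (a t + inner ℝ (v t) (y - x t))
      = ∑ t ∈ Finset.range n, w t * (a t + inner ℝ (v t) (z - x t))
        + inner ℝ (y - z) (∑ t ∈ Finset.range n, w t • v t) := by
  simp only [inner_sum, ← Finset.sum_add_distrib]
  refine Finset.sum_congr rfl fun t _ => ?_
  simp only [inner_smul_right, inner_sub_left, inner_sub_right, real_inner_comm]
  ring

variable (k : ℕ)

theorem sum_silverStep_smul_succ {M : Type*} [AddCommGroup M] [Module ℝ M] (F : ℕ → M) :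
    ∑ t ∈ Finset.range (horizon (k + 2)), silverStep t • F t
      = ∑ t ∈ Finset.range (horizon (k + 1)), silverStep t • F t
        + (rho ^ k + 1) • F (horizon (k + 1))
        + ∑ t ∈ Finset.range (horizon (k + 1)), silverStep t • F (horizon (k + 1) + 1 + t) := by
  rw [horizon_add_two, sum_range_glue, silverStep_horizon]
  exact congrArg _ (Finset.sum_congr rfl fun t ht => by
    rw [silverStep_shift (Finset.mem_range.1 ht)])

theorem sum_cSubPi_smul_succ {M : Type*} [AddCommGroup M] [Module ℝ M] (F : ℕ → M) :
    ∑ t ∈ Finset.range (horizon (k + 2)), cSubPi (k + 2) (t + 1) • F t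
      = (1 / rho ^ (k + 1) * (rho ^ k + 1)) • F (horizon (k + 1))
        + rho • ∑ t ∈ Finset.range (horizon (k + 1)),
            cSubPi (k + 1) (t + 1) • F (horizon (k + 1) + 1 + t)
        + (1 / rho ^ (k + 1)) • ∑ t ∈ Finset.range (horizon (k + 1)),
            silverStep t • F (horizon (k + 1) + 1 + t) := by
  rw [horizon_add_two, sum_range_glue, cSubPi_mid, Finset.smul_sum, Finset.smul_sum,
    Finset.sum_eq_zero, zero_add, add_assoc, ← Finset.sum_add_distrib]
  · exact congrArg _ (Finset.sum_congr rfl fun t ht => by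
      rw [cSubPi_right k (Finset.mem_range.1 ht), add_smul, mul_smul, mul_smul])
  · intro t ht
    rw [cSubPi_left k (Finset.mem_range.1 ht), zero_smul]

theorem sub_eq_of_step {x g s : ℕ → E} {n : ℕ}
    (hx : ∀ t < n, x (t + 1) = x t - silverStep t • (g t + s (t + 1))) :
    x 0 - x n = ∑ t ∈ Finset.range n, silverStep t • g t
      + ∑ t ∈ Finset.range n, silverStep t • s (t + 1) := by
  induction n with
  | zero => simp
  | succ n ih =>
    rw [Finset.sum_range_succ, Finset.sum_range_succ, hx n (by omega), smul_add]
    have h := ih fun t ht => hx t (by omega)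
    rw [sub_eq_iff_eq_add] at h ⊢
    rw [h]
    abel

/-- The algebraic core of the induction step. Here `u = ρ`, `D = ρ ^ k + 1` is the step between
the two copies, so that `u * (D - 1) = ρ ^ (k + 1)`, and `q = ρ ^ (-(k + 1))`, `r = D⁻¹`. The
vectors `G`, `P`, `A` are the sums of the `g`'s weighted by the stepsizes, of the `s`'s weighted by the
stepsizes and of the `s`'s weighted by `c - π`, `γ` is the last `g`, and `σ` is the `s` between
the two copies; primes refer to the second copy. -/
theorem glue_identity {u D q r : ℝ} (hu : u ^ 2 = 2 * u + 1) (hr : D * r = 1)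
    (hq : D * q = q + u - 2) (G P A γ σ G' P' A' γ' : E)
    (fn fN hn hm hN a a' b b' d d' l l' L L' : ℝ) :
    -(2 * (u * (D - 1)) - 1) * (fn + hn) + a
          + u * (D - 1) * (fn + inner ℝ γ (G + P) + 1 / 2 * ‖γ‖ ^ 2) + b + d + l
          - 1 / 2 * ‖G + (u * (D - 1)) • γ + P + A‖ ^ 2 - 1 / 2 * (L - ‖A‖ ^ 2)
      + u ^ 2 * (-(2 * (u * (D - 1)) - 1) * (fN + hN) + a'
          + u * (D - 1) * (fN + inner ℝ γ' (G' + P') + 1 / 2 * ‖γ'‖ ^ 2) + b' + d' + l'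
          - 1 / 2 * ‖G' + (u * (D - 1)) • γ' + P' + A'‖ ^ 2 - 1 / 2 * (L' - ‖A'‖ ^ 2))
      + u * (fn - fN - inner ℝ γ' (G' + P' + D • (γ + σ)) - 1 / 2 * ‖γ - γ'‖ ^ 2)
      + u * (D - 1) * (fN - fn - inner ℝ γ (-(G' + P' + D • (γ + σ))) - 1 / 2 * ‖γ' - γ‖ ^ 2)
      + u * ((u * (D - 1) - 1) * (fn - 1 / 2 * ‖γ‖ ^ 2) - a' + inner ℝ (γ - D • (γ + σ)) G')
      + u * ((u * (D - 1) - 1) * (fN - 1 / 2 * ‖γ'‖ ^ 2) - a' + inner ℝ (γ' + (G' + P')) G')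
      + u * (D - 1) * (hn - hm - inner ℝ σ (D • (γ + σ)))
      + u ^ 2 * (hm - l')
      + (u - q) * D * (hN - hm - inner ℝ σ (-(G' + P')))
      + (1 - u * (D - 1) * r) * ((u * (D - 1) - 1) * hn - d + inner ℝ (G + P) A)
      + u * (D - 1) * r * ((u * (D - 1) - 1) * hm - d + inner ℝ (G + P + D • (γ + σ)) A)
      + u * (D - 1) * r * ((u * (D - 1) - 1) * hn - b' + inner ℝ (-(D • (γ + σ))) P')
      + u * r * ((u * (D - 1) - 1) * hm - b')
      + (u + 1) * ((u * (D - 1) - 1) * hN - d' + inner ℝ (G' + P') A')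
      + (u - q) * ((u * (D - 1) - 1) * hN - b' + inner ℝ (G' + P') P')
    = -(2 * (u * (u * (D - 1))) - 1) * (fN + hN)
      + (a + D * (fn + inner ℝ γ (G + P) + 1 / 2 * ‖γ‖ ^ 2)
        + (a' + inner ℝ (G + P + D • (γ + σ)) G'))
      + u * (u * (D - 1)) * (fN + inner ℝ γ' (G + P + D • (γ + σ) + (G' + P')) + 1 / 2 * ‖γ'‖ ^ 2)
      + (b + D * (hm + inner ℝ σ (G + P + D • (γ + σ)))
        + (b' + inner ℝ (G + P + D • (γ + σ)) P'))
      + (q * D * (hm + inner ℝ σ (G + P + D • (γ + σ)))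
        + u * (d' + inner ℝ (G + P + D • (γ + σ)) A')
        + q * (b' + inner ℝ (G + P + D • (γ + σ)) P'))
      + l
      - 1 / 2 * ‖G + D • γ + G' + (u * (u * (D - 1))) • γ' + (P + D • σ + P')
          + ((q * D) • σ + u • A' + q • P')‖ ^ 2
      - 1 / 2 * (L + u ^ 2 * L' - 2 * (u * (D - 1)) * inner ℝ σ A
          + D * (u * (u * (D - 1)) + 1) * ‖σ‖ ^ 2 - 2 * u * inner ℝ σ P'
          - ‖(q * D) • σ + u • A' + q • P'‖ ^ 2) := by
  simp only [← real_inner_self_eq_norm_sq, inner_add_left, inner_add_right, inner_sub_left,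
    inner_sub_right, inner_neg_left, inner_neg_right, real_inner_smul_right,
    real_inner_comm]
  linear_combination
    (a' + b' + d' + fN * (1 + u - u * D) + fn * (D - 1) + hm * (1 - D * r + D ^ 2 * r)
      + hN * (2 * u - 2 * u * D) - inner ℝ G' A' - inner ℝ P' A' - 1 / 2 * inner ℝ G' G'
      - inner ℝ G' P' - 1 / 2 * inner ℝ P' P' + inner ℝ P' γ' * (D * q - q + 2)
      + inner ℝ γ γ * (1 / 2 * D - 1 / 2 * D ^ 2) + inner ℝ σ σ * (1 / 2 * D ^ 2 - 1 / 2 * D)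
      + inner ℝ σ γ' * (D ^ 2 * q - D * q + 2 * D)
      + inner ℝ γ' γ' * (1 / 2 * u * D - 1 / 2 * u)) * hu
    + (-u * b' + hm * (2 * u * D - 3 * u - 1 + D) + inner ℝ A γ * (u * D - u)
      + inner ℝ A σ * (u * D - u) + inner ℝ γ P' * (u - u * D)
      + inner ℝ σ P' * (u - u * D)) * hr
    + (-hN * (1 + u) + inner ℝ P' γ' * (1 + 2 * u) + inner ℝ σ γ' * (D + 2 * u * D)) * hq
/-- The descent identity with the terms that involve the minimizer removed. It holds for arbitrary
scalars `f`, `h` and vectors `g`, `s` as soon as the points `x` follow the update rule. -/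
theorem sum_multipliers (f h : ℕ → ℝ) (x g s : ℕ → E)
    (hx : ∀ t < horizon (k + 1), x (t + 1) = x t - silverStep t • (g t + s (t + 1))) :
    ∑ i ∈ Finset.range (horizon (k + 1) + 1), ∑ j ∈ Finset.range (horizon (k + 1) + 1),
        lamBar (k + 1) i j * coco f x g i j
      + ∑ i ∈ Finset.range (horizon (k + 1)), ∑ j ∈ Finset.range (horizon (k + 1)),
          muBar (k + 1) (i + 1) (j + 1) * linGap h x s (i + 1) (j + 1)
      = -(2 * rho ^ (k + 1) - 1) * (f (horizon (k + 1)) + h (horizon (k + 1)))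
        + ∑ t ∈ Finset.range (horizon (k + 1)), silverStep t
            * (f t + 1 / 2 * ‖g t‖ ^ 2 + inner ℝ (g t) (x 0 - x t))
        + rho ^ (k + 1) * (f (horizon (k + 1))
            + inner ℝ (g (horizon (k + 1))) (x 0 - x (horizon (k + 1)))
            + 1 / 2 * ‖g (horizon (k + 1))‖ ^ 2)
        + ∑ t ∈ Finset.range (horizon (k + 1)), silverStep t
            * (h (t + 1) + inner ℝ (s (t + 1)) (x 0 - x (t + 1)))
        + ∑ t ∈ Finset.range (horizon (k + 1)), cSubPi (k + 1) (t + 1)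
            * (h (t + 1) + inner ℝ (s (t + 1)) (x 0 - x (t + 1)))
        + (h 1 + inner ℝ (s 1) (x 0 - x 1))
        - 1 / 2 * ‖∑ t ∈ Finset.range (horizon (k + 1)), silverStep t • g t
            + rho ^ (k + 1) • g (horizon (k + 1))
            + ∑ t ∈ Finset.range (horizon (k + 1)), silverStep t • s (t + 1)
            + ∑ t ∈ Finset.range (horizon (k + 1)), cSubPi (k + 1) (t + 1) • s (t + 1)‖ ^ 2
        - 1 / 2 * (∑ i ∈ Finset.range (horizon (k + 1)), ∑ j ∈ Finset.range (horizon (k + 1)),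
              LHat (k + 1) (i + 1) (j + 1) * inner ℝ (s (i + 1)) (s (j + 1))
            - ‖∑ t ∈ Finset.range (horizon (k + 1)),
                cSubPi (k + 1) (t + 1) • s (t + 1)‖ ^ 2) := by
  induction k generalizing f h x g s with
  | zero =>
    have hx₁ := hx 0 (by simp [horizon_one])
    simp only [zero_add, silverStep_zero] at hx₁
    have hδ : cSubPi 1 1 = rho - 1 := by
      rw [cSubPi_eq (j := 0) one_pos, zero_add, cSeq_one, silverStep_zero]; ring
    have hd : x 1 - x 0 = -((rho - 1) • (g 0 + s 1)) := by rw [hx₁]; abel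
    have hd' : x 0 - x 1 = (rho - 1) • (g 0 + s 1) := by rw [hx₁]; abel
    simp only [zero_add, horizon_one, Finset.sum_range_succ, Finset.range_zero, Finset.sum_empty]
    simp only [lamBar, muBar, silverStep_zero, LHat_one, hδ, coco, hd, hd', zero_add, pow_one,
      sub_self, inner_zero_right, zero_mul, if_true, one_ne_zero, zero_ne_one,
      and_self, and_true, and_false, if_false]
    simp only [← real_inner_self_eq_norm_sq, inner_add_left, inner_add_right, inner_sub_left,
      inner_sub_right, inner_neg_right, real_inner_smul_right,
      real_inner_comm]
    linear_combination (1 / 2 * inner ℝ (g 0) (g 0) + 1 / 2 * inner ℝ (g 1) (g 1)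
      - inner ℝ (g 0) (g 1) - 1 / 2 * inner ℝ (s 1) (s 1)) * rho_sq
  | succ k ih =>
    have hlt {t : ℕ} (ht : t < horizon (k + 1)) : t < horizon (k + 2) := by
      rw [horizon_add_two]; omega
    have hlt' {t : ℕ} (ht : t < horizon (k + 1)) : horizon (k + 1) + 1 + t < horizon (k + 2) := by
      rw [horizon_add_two]; omega
    have hx' (t : ℕ) (ht : t < horizon (k + 1)) :
        x (horizon (k + 1) + 1 + (t + 1)) = x (horizon (k + 1) + 1 + t) - silverStep t •
          (g (horizon (k + 1) + 1 + t) + s (horizon (k + 1) + 1 + (t + 1))) := by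
      rw [← silverStep_shift ht]
      exact hx _ (hlt' ht)
    -- the iterates from `n + 1` on are again iterates of the silver schedule of the previous level
    have ih₁ := ih f h x g s fun t ht => hx t (hlt ht)
    have ih₂ := ih (fun t => f (horizon (k + 1) + 1 + t)) (fun t => h (horizon (k + 1) + 1 + t))
      (fun t => x (horizon (k + 1) + 1 + t)) (fun t => g (horizon (k + 1) + 1 + t))
      (fun t => s (horizon (k + 1) + 1 + t)) hx'
    have hd₁ := sub_eq_of_step fun t ht => hx t (hlt ht)
    have hd₂ := hx (horizon (k + 1)) (by rw [horizon_add_two]; omega)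
    rw [silverStep_horizon] at hd₂
    have hd₃ := sub_eq_of_step (x := fun t => x (horizon (k + 1) + 1 + t))
      (g := fun t => g (horizon (k + 1) + 1 + t)) (s := fun t => s (horizon (k + 1) + 1 + t)) hx'
    -- all sums at the new level, through sums over the two copies
    have hlam := sum_lamBar_succ k (coco f x g)
    have hmu := sum_muBar_succ k (linGap h x s)
    have hL := sum_LHat_succ k (fun i j => inner ℝ (s i) (s j)) fun i j => real_inner_comm _ _
    have hf := sum_silverStep_smul_succ k
      fun t => f t + 1 / 2 * ‖g t‖ ^ 2 + inner ℝ (g t) (x 0 - x t)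
    have hh := sum_silverStep_smul_succ k fun t => h (t + 1) + inner ℝ (s (t + 1)) (x 0 - x (t + 1))
    have hh' := sum_cSubPi_smul_succ k fun t => h (t + 1) + inner ℝ (s (t + 1)) (x 0 - x (t + 1))
    have hg := sum_silverStep_smul_succ k g
    have hs := sum_silverStep_smul_succ k fun t => s (t + 1)
    have hs' := sum_cSubPi_smul_succ k fun t => s (t + 1)
    have hw := sum_silverStep k
    have hw' := sum_cSubPi k
    have hN : horizon (k + 1 + 1) = horizon (k + 1) + 1 + horizon (k + 1) := by
      rw [horizon_add_two]; ring
    -- the second copy is based at its own starting point `x (n + 1)`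
    have hcoco (i : ℕ) := sum_mul_coco silverStep (horizon (k + 1))
      (fun t => horizon (k + 1) + 1 + t) f x g i (x (horizon (k + 1) + 1))
    have hgap (i : ℕ) := sum_mul_linGap (fun t => cSubPi (k + 1) (t + 1)) (horizon (k + 1))
      (fun t => t + 1) h x s i (x 0)
    have hgap₁ (i : ℕ) := sum_mul_linGap silverStep (horizon (k + 1))
      (fun t => horizon (k + 1) + 1 + t + 1) h x s i (x (horizon (k + 1) + 1))
    have hgap₂ (i : ℕ) := sum_mul_linGap (fun t => cSubPi (k + 1) (t + 1)) (horizon (k + 1))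
      (fun t => horizon (k + 1) + 1 + t + 1) h x s i (x (horizon (k + 1) + 1))
    have hbase₁ := sum_mul_add_inner_rebase silverStep (horizon (k + 1))
      (fun t => f (horizon (k + 1) + 1 + t) + 1 / 2 * ‖g (horizon (k + 1) + 1 + t)‖ ^ 2)
      (fun t => g (horizon (k + 1) + 1 + t)) (fun t => x (horizon (k + 1) + 1 + t))
      (x 0) (x (horizon (k + 1) + 1))
    have hbase₂ (w : ℕ → ℝ) := sum_mul_add_inner_rebase w (horizon (k + 1))
      (fun t => h (horizon (k + 1) + 1 + t + 1)) (fun t => s (horizon (k + 1) + 1 + t + 1))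
      (fun t => x (horizon (k + 1) + 1 + t + 1)) (x 0) (x (horizon (k + 1) + 1))
    have hinner (w : ℕ → ℝ) (y : E) (v : ℕ → E) : ∑ j ∈ Finset.range (horizon (k + 1)),
        w j * inner ℝ y (v j) = inner ℝ y (∑ j ∈ Finset.range (horizon (k + 1)), w j • v j) := by
      simp only [inner_sum, real_inner_smul_right]
    rw [hinner _ _ fun j => s (horizon (k + 1) + 1 + (j + 1)),
      hinner (fun j => cSubPi (k + 1) (j + 1)) _ fun j => s (j + 1)] at hL
    have hT (i j : ℕ) : coco (fun t => f (horizon (k + 1) + 1 + t))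
        (fun t => x (horizon (k + 1) + 1 + t)) (fun t => g (horizon (k + 1) + 1 + t)) i j
        = coco f x g (horizon (k + 1) + 1 + i) (horizon (k + 1) + 1 + j) := rfl
    have hT' (i j : ℕ) : linGap (fun t => h (horizon (k + 1) + 1 + t))
        (fun t => x (horizon (k + 1) + 1 + t)) (fun t => s (horizon (k + 1) + 1 + t)) i j
        = linGap h x s (horizon (k + 1) + 1 + i) (horizon (k + 1) + 1 + j) := rfl
    simp only [hT, hT', smul_eq_mul, ← add_assoc, add_zero] at hf hh hh' ih₂ hd₃ hmu hL
    beta_reduce at hcoco hgap hgap₁ hgap₂ hbase₁ hbase₂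
    rw [hlam, hmu, hL, hf, hh, hh', hg, hs, hs', hN]
    simp only [hcoco, hgap, hgap₁, hgap₂, hbase₁, hbase₂, hw, hw']
    clear ih hx hx' hlt hlt' hN hinner hT hT' hw hw' hlam hmu hL hf hh hh' hg hs hs' hcoco
      hgap hgap₁ hgap₂ hbase₁ hbase₂
    generalize horizon (k + 1) = n at *
    have hD : rho ^ k + 1 ≠ 0 := (add_pos (pow_pos rho_pos k) one_pos).ne'
    have hr := rho_pos.ne'
    have hq : (rho ^ k + 1) * (1 / rho ^ (k + 1)) = 1 / rho ^ (k + 1) + rho - 2 := by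
      rw [add_sub_assoc, ← rho_inv, pow_succ]
      field_simp
      ring
    have key := glue_identity rho_sq (mul_one_div_cancel hD) hq
      (∑ t ∈ Finset.range n, silverStep t • g t) (∑ t ∈ Finset.range n, silverStep t • s (t + 1))
      (∑ t ∈ Finset.range n, cSubPi (k + 1) (t + 1) • s (t + 1)) (g n) (s (n + 1))
      (∑ t ∈ Finset.range n, silverStep t • g (n + 1 + t))
      (∑ t ∈ Finset.range n, silverStep t • s (n + 1 + t + 1))
      (∑ t ∈ Finset.range n, cSubPi (k + 1) (t + 1) • s (n + 1 + t + 1)) (g (n + 1 + n))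
      (f n) (f (n + 1 + n)) (h n) (h (n + 1)) (h (n + 1 + n))
      (∑ t ∈ Finset.range n, silverStep t * (f t + 1 / 2 * ‖g t‖ ^ 2 + inner ℝ (g t) (x 0 - x t)))
      (∑ t ∈ Finset.range n, silverStep t * (f (n + 1 + t) + 1 / 2 * ‖g (n + 1 + t)‖ ^ 2
        + inner ℝ (g (n + 1 + t)) (x (n + 1) - x (n + 1 + t))))
      (∑ t ∈ Finset.range n, silverStep t * (h (t + 1) + inner ℝ (s (t + 1)) (x 0 - x (t + 1))))
      (∑ t ∈ Finset.range n, silverStep t * (h (n + 1 + t + 1)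
        + inner ℝ (s (n + 1 + t + 1)) (x (n + 1) - x (n + 1 + t + 1))))
      (∑ t ∈ Finset.range n, cSubPi (k + 1) (t + 1)
        * (h (t + 1) + inner ℝ (s (t + 1)) (x 0 - x (t + 1))))
      (∑ t ∈ Finset.range n, cSubPi (k + 1) (t + 1) * (h (n + 1 + t + 1)
        + inner ℝ (s (n + 1 + t + 1)) (x (n + 1) - x (n + 1 + t + 1))))
      (h 1 + inner ℝ (s 1) (x 0 - x 1))
      (h (n + 1 + 1) + inner ℝ (s (n + 1 + 1)) (x (n + 1) - x (n + 1 + 1)))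
      (∑ i ∈ Finset.range n, ∑ j ∈ Finset.range n,
        LHat (k + 1) (i + 1) (j + 1) * inner ℝ (s (i + 1)) (s (j + 1)))
      (∑ i ∈ Finset.range n, ∑ j ∈ Finset.range n,
        LHat (k + 1) (i + 1) (j + 1) * inner ℝ (s (n + 1 + i + 1)) (s (n + 1 + j + 1)))
    have hR : rho * (rho ^ k + 1 - 1) = rho ^ (k + 1) := by ring
    have hR' : rho * rho ^ (k + 1) = rho ^ (k + 1 + 1) := by ring
    simp only [hR, hR'] at key
    generalize (∑ t ∈ Finset.range n, silverStep t • g t) = G at *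
    generalize (∑ t ∈ Finset.range n, silverStep t • s (t + 1)) = P at *
    generalize (∑ t ∈ Finset.range n, silverStep t • g (n + 1 + t)) = G' at *
    generalize (∑ t ∈ Finset.range n, silverStep t • s (n + 1 + t + 1)) = P' at *
    -- by the update rule, `x` enters only through differences that are combinations of `g` and `s`
    have hv₁ : x n - x (n + 1) = (rho ^ k + 1) • (g n + s (n + 1)) := by rw [hd₂]; abel
    have hv₂ : x (n + 1) - x n = -((rho ^ k + 1) • (g n + s (n + 1))) := by rw [hd₂]; abel
    have hv₃ : x n - x (n + 1 + n) = G' + P' + (rho ^ k + 1) • (g n + s (n + 1)) := by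
      rw [← hd₃, ← hv₁]; abel
    have hv₄ : x (n + 1 + n) - x n = -(G' + P' + (rho ^ k + 1) • (g n + s (n + 1))) := by
      rw [← hv₃]; abel
    have hv₅ : x (n + 1 + n) - x (n + 1) = -(G' + P') := by rw [← hd₃]; abel
    have hv₆ : x 0 - x (n + 1) = G + P + (rho ^ k + 1) • (g n + s (n + 1)) := by
      rw [← hd₁, ← hv₁]; abel
    have hv₇ : x 0 - x (n + 1 + n)
        = G + P + (rho ^ k + 1) • (g n + s (n + 1)) + (G' + P') := by
      rw [← hv₆, ← hd₃]; abel
    have hv₈ : g n + x (n + 1) - x n = g n - (rho ^ k + 1) • (g n + s (n + 1)) := by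
      rw [add_sub_assoc, hv₂, sub_eq_add_neg]
    have hv₉ : g (n + 1 + n) + x (n + 1) - x (n + 1 + n) = g (n + 1 + n) + (G' + P') := by
      rw [add_sub_assoc, hd₃]
    simp only [coco, linGap, hd₁, hd₃, hv₁, hv₂, hv₃, hv₄, hv₅, hv₆, hv₇, hv₈, hv₉, sub_self,
      inner_zero_left, real_inner_self_eq_norm_sq] at ih₁ ih₂ key ⊢
    linear_combination ih₁ + rho ^ 2 * ih₂ + key
end SilverProx

/-! ### Subgradients from optimality conditions -/

namespace SilverProx

variable {d : ℕ} {f : EuclideanSpace ℝ (Fin d) → ℝ} {h : EuclideanSpace ℝ (Fin d) → EReal}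

open Filter Topology in
/-- First-order optimality: if `p` minimizes `h + φ` with `h` convex and `φ` differentiable at `p`,
then `-∇φ(p)` is a subgradient of `h` at `p`. -/
theorem isSubgradient_of_forall_le {φ : EuclideanSpace ℝ (Fin d) → ℝ}
    {p v : EuclideanSpace ℝ (Fin d)} (hh : ProperConvex h) (hφ : HasGradientAt φ (-v) p)
    (hmin : ∀ z, h p + (φ p : EReal) ≤ h z + (φ z : EReal)) : IsSubgradient h p v := by
  obtain ⟨hbot, ⟨z₀, hz₀⟩, hconv⟩ := hh
  have hp : h p ≠ ⊤ := by
    intro htop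
    have h₁ := hmin z₀
    rw [htop, EReal.top_add_coe, top_le_iff] at h₁
    exact EReal.add_ne_top hz₀ (EReal.coe_ne_top _) h₁
  refine ⟨hbot p, hp, fun y => ?_⟩
  by_cases hy : h y = ⊤
  · rw [hy]; exact le_top
  lift h p to ℝ using ⟨hp, hbot p⟩ with a ha
  lift h y to ℝ using ⟨hy, hbot y⟩ with b hb
  rw [← EReal.coe_add, EReal.coe_le_coe_iff]
  -- along the segment from `p` to `y`, convexity of `h` and minimality of `p` give
  -- `0 ≤ b - a + (φ(p + t (y - p)) - φ p) / t`
  have key : ∀ t ∈ Set.Ioc (0 : ℝ) 1, 0 ≤ b - a + t⁻¹ • (φ (p + t • (y - p)) - φ p) := by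
    rintro t ⟨ht, ht'⟩
    have h₁ := hconv (x := (p, a)) ha.ge (y := (y, b)) hb.ge (sub_nonneg.2 ht') ht.le (by ring)
    have e : (1 - t) • p + t • y = p + t • (y - p) := by
      rw [sub_smul, smul_sub, one_smul]; abel
    simp only [Prod.smul_mk, Prod.mk_add_mk, Set.mem_ofPred_eq, e, smul_eq_mul] at h₁
    have h₂ := (hmin (p + t • (y - p))).trans (add_le_add_left h₁ _)
    rw [← EReal.coe_add, ← EReal.coe_add, EReal.coe_le_coe_iff] at h₂
    have h₃ : 0 ≤ t⁻¹ * (t * (b - a) + (φ (p + t • (y - p)) - φ p)) :=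
      mul_nonneg (inv_nonneg.2 ht.le) (by linarith)
    rw [mul_add, inv_mul_cancel_left₀ ht.ne'] at h₃
    exact h₃
  have hlim : Tendsto (fun t : ℝ => b - a + t⁻¹ • (φ (p + t • (y - p)) - φ p)) (𝓝[>] 0)
      (𝓝 (b - a + inner ℝ (-v) (y - p))) := by
    refine tendsto_const_nhds.add ?_
    have h₁ := hφ.hasFDerivAt.hasLineDerivAt (y - p)
    have h₂ := h₁.tendsto_slope_zero_right
    simpa using h₂
  have h₁ := ge_of_tendsto hlim (eventually_of_mem (Ioc_mem_nhdsGT one_pos) key)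
  rw [inner_neg_left] at h₁
  linarith

theorem isSubgradient_of_isProx (hh : ProperConvex h) {α : ℝ} (hα : 0 < α)
    {w p v : EuclideanSpace ℝ (Fin d)} (hp : IsProx h α w p) (hv : p = w - α • v) :
    IsSubgradient h p v := by
  refine isSubgradient_of_forall_le (φ := fun z => 1 / (2 * α) * ‖z - w‖ ^ 2) hh ?_ hp
  have h₁ : HasFDerivAt (fun z : EuclideanSpace ℝ (Fin d) => ‖z - w‖ ^ 2)
      (2 • (innerSL ℝ (p - w)).comp (ContinuousLinearMap.id ℝ _)) p :=
    ((hasFDerivAt_id p).sub_const w).norm_sq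
  have h₂ := h₁.const_mul (1 / (2 * α))
  rw [hasGradientAt_iff_hasFDerivAt]
  refine h₂.congr_fderiv ?_
  ext z
  have e : p - w = -(α • v) := by rw [hv]; abel
  simp [e]
  field_simp

theorem isSubgradient_of_isMinimizer (hf : Differentiable ℝ f) (hh : ProperConvex h)
    {p v : EuclideanSpace ℝ (Fin d)} (hp : IsMinimizer f h p) (hv : gradient f p + v = 0) :
    IsSubgradient h p v := by
  refine isSubgradient_of_forall_le (φ := f) hh ?_ fun z => ?_
  · rw [← eq_neg_of_add_eq_zero_left hv]
    exact (hf p).hasGradientAt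
  · rw [add_comm (h p), add_comm (h z)]
    exact hp z

end SilverProx

/-! ### The full descent identity -/

namespace SilverProx

theorem sum_Icc_one {M : Type*} [AddCommMonoid M] (n : ℕ) (F : ℕ → M) :
    ∑ j ∈ Finset.Icc 1 n, F j = ∑ j ∈ Finset.range n, F (j + 1) := by
  induction n with
  | zero => simp
  | succ n ih => rw [Finset.sum_Icc_succ_top (by omega), ih, Finset.sum_range_succ]

variable (k : ℕ)

theorem sum_cSeq_smul {M : Type*} [AddCommGroup M] [Module ℝ M] (F : ℕ → M) :
    ∑ j ∈ Finset.range (horizon k), cSeq k (j + 1) • F j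
      = ∑ j ∈ Finset.range (horizon k), silverStep j • F j
        + ∑ j ∈ Finset.range (horizon k), cSubPi k (j + 1) • F j := by
  rw [← Finset.sum_add_distrib]
  exact Finset.sum_congr rfl fun j hj => by
    rw [cSubPi_eq (Finset.mem_range.1 hj), ← add_smul, add_sub_cancel]

variable {E : Type*} [NormedAddCommGroup E] [InnerProductSpace ℝ E]

theorem sum_LBar_inner (s : ℕ → E) :
    ∑ i ∈ Finset.range (horizon k), ∑ j ∈ Finset.range (horizon k),
        LBar k (i + 1) (j + 1) * inner ℝ (s i) (s j)
      = ∑ i ∈ Finset.range (horizon k), ∑ j ∈ Finset.range (horizon k),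
          LHat k (i + 1) (j + 1) * inner ℝ (s i) (s j)
        - ‖∑ t ∈ Finset.range (horizon k), cSubPi k (t + 1) • s t‖ ^ 2 := by
  rw [← real_inner_self_eq_norm_sq, sum_inner, ← Finset.sum_sub_distrib]
  refine Finset.sum_congr rfl fun i _ => ?_
  rw [inner_sum, ← Finset.sum_sub_distrib]
  refine Finset.sum_congr rfl fun j _ => ?_
  rw [LHat, real_inner_smul_left, real_inner_smul_right]
  ring

/-- The descent identity for arbitrary scalars `f`, `h` and vectors `g`, `s`: only the update rule
and the optimality condition `g_* + s_* = 0` are used. -/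
theorem descent_identity (f h : Option ℕ → ℝ) (x g s : Option ℕ → E)
    (hx : ∀ t < horizon (k + 1), x (some (t + 1))
      = x (some t) - silverStep t • (g (some t) + s (some (t + 1))))
    (hs : g none + s none = 0) :
    ∑ i ∈ idxF (k + 1), ∑ j ∈ Finset.range (horizon (k + 1) + 1),
        lam (k + 1) i j * coco f x g i (some j)
      + ∑ i ∈ idxH (k + 1), ∑ j ∈ Finset.Icc 1 (horizon (k + 1)),
        mu (k + 1) i j * linGap h x s i (some j)
      = (2 * rho ^ (k + 1) - 1) * (f none + h none
          - (f (some (horizon (k + 1))) + h (some (horizon (k + 1)))))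
        + rho / (2 * Real.sqrt 2) * ‖x (some 0) - x none‖ ^ 2
        - 1 / 2 * (‖x (some 0) - x none
              - ∑ i ∈ Finset.range (horizon (k + 1)), silverStep i • g (some i)
              - rho ^ (k + 1) • g (some (horizon (k + 1)))
              - ∑ j ∈ Finset.Icc 1 (horizon (k + 1)), cSeq (k + 1) j • s (some j) - s none‖ ^ 2
          + (1 / Real.sqrt 2 * inner ℝ (x (some 0) - x none) (x (some 0) - x none)
            + 2 * (inner ℝ (x (some 0) - x none) (s none)
              - inner ℝ (x (some 0) - x none) (s (some 1)))
            + ∑ i ∈ Finset.range (horizon (k + 1)), ∑ j ∈ Finset.range (horizon (k + 1)),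
                LBar (k + 1) (i + 1) (j + 1) * inner ℝ (s (some (i + 1))) (s (some (j + 1)))
            - 2 * ∑ i ∈ Finset.range (horizon (k + 1)),
                cSeq (k + 1) (i + 1) * inner ℝ (s (some (i + 1))) (s none)
            + 2 * (rho ^ (k + 1) - 1) * inner ℝ (s none) (s none))) := by
  have hsum := sum_multipliers k (fun t => f (some t)) (fun t => h (some t))
    (fun t => x (some t)) (fun t => g (some t)) (fun t => s (some t)) hx
  have hlam : ∑ j ∈ Finset.range (horizon (k + 1) + 1),
      lamStar (k + 1) j * coco f x g none (some j)
      = ∑ j ∈ Finset.range (horizon (k + 1)), silverStep j * coco f x g none (some j)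
        + rho ^ (k + 1) * coco f x g none (some (horizon (k + 1))) := by
    rw [Finset.sum_range_succ, lamStar, if_neg (lt_irrefl _), if_pos rfl]
    refine congrArg (· + _) (Finset.sum_congr rfl fun j hj => ?_)
    rw [lamStar, if_pos (Finset.mem_range.1 hj), piSeq_succ_left (Finset.mem_range.1 hj)]
  have hmu : ∑ j ∈ Finset.range (horizon (k + 1)),
      muStar (k + 1) (j + 1) * linGap h x s none (some (j + 1))
      = ∑ j ∈ Finset.range (horizon (k + 1)), silverStep j * linGap h x s none (some (j + 1))
        + ∑ j ∈ Finset.range (horizon (k + 1)),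
            cSubPi (k + 1) (j + 1) * linGap h x s none (some (j + 1))
        + linGap h x s none (some 1) := by
    have h₁ := sum_cSeq_smul (k + 1) fun j => linGap h x s none (some (j + 1))
    simp only [smul_eq_mul] at h₁
    simp only [muStar, add_mul, Finset.sum_add_distrib, h₁, Nat.add_eq_right, ite_mul, one_mul,
      zero_mul]
    rw [Finset.sum_ite_eq', if_pos (Finset.mem_range.2 (horizon_succ_pos k))]
  have hcoco := sum_mul_coco silverStep (horizon (k + 1)) some f x g none (x (some 0))
  have hgap (w : ℕ → ℝ) := sum_mul_linGap w (horizon (k + 1)) (fun j => some (j + 1)) h x s none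
    (x (some 0))
  have hcs := sum_cSeq_smul (k + 1) fun j => s (some (j + 1))
  have hcs' : ∑ i ∈ Finset.range (horizon (k + 1)),
      cSeq (k + 1) (i + 1) * inner ℝ (s (some (i + 1))) (s none)
      = inner ℝ (∑ i ∈ Finset.range (horizon (k + 1)), cSeq (k + 1) (i + 1) • s (some (i + 1)))
          (s none) := by
    simp only [sum_inner, real_inner_smul_left]
  rw [idxF, idxH, Finset.sum_insertNone, Finset.sum_insertNone]
  simp only [lam, mu, sum_Icc_one]
  rw [hlam, hmu, hcoco, hgap, hgap fun j => cSubPi (k + 1) (j + 1), sum_silverStep, sum_cSubPi,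
    hcs', hcs, sum_LBar_inner (k + 1) fun i => s (some (i + 1))]
  have hT (i j : ℕ) : coco (fun t => f (some t)) (fun t => x (some t)) (fun t => g (some t)) i j
      = coco f x g (some i) (some j) := rfl
  have hT' (i j : ℕ) : linGap (fun t => h (some t)) (fun t => x (some t)) (fun t => s (some t)) i j
      = linGap h x s (some i) (some j) := rfl
  simp only [hT, hT'] at hsum
  have hs' : s none = -g none := (neg_eq_of_add_eq_zero_right hs).symm
  clear hlam hmu hcoco hgap hcs hcs' hT hT' hx hs
  generalize horizon (k + 1) = n at *
  generalize (∑ t ∈ Finset.range n, silverStep t • g (some t)) = G at *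
  generalize (∑ t ∈ Finset.range n, silverStep t • s (some (t + 1))) = P at *
  generalize (∑ t ∈ Finset.range n, cSubPi (k + 1) (t + 1) • s (some (t + 1))) = A at *
  have hv₁ : g none + x (some 0) - x none = g none + (x (some 0) - x none) := add_sub_assoc _ _ _
  have hv₂ (i : ℕ) : x none - x (some i) = (x (some 0) - x (some i)) - (x (some 0) - x none) := by
    abel
  have h2 : rho / (2 * Real.sqrt 2) = 1 / 2 + 1 / 2 * (1 / Real.sqrt 2) := by
    have : Real.sqrt 2 ≠ 0 := (Real.sqrt_pos.2 (by norm_num)).ne'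
    rw [rho]
    field_simp
    ring
  generalize hl : coco f x g none (some n) = l₁
  generalize hl' : linGap h x s none (some 1) = l₂
  rw [coco, hv₂] at hl
  rw [linGap, hv₂] at hl'
  rw [hv₁, h2, hs', ← hl, ← hl']
  generalize x (some 0) - x none = D at *
  generalize x (some 0) - x (some n) = Y at *
  generalize x (some 0) - x (some 1) = Y' at *
  generalize 1 / Real.sqrt 2 = q
  generalize g (some n) = γ at *
  generalize g none = γ' at *
  simp only [← real_inner_self_eq_norm_sq, inner_add_left, inner_add_right, inner_sub_left,
    inner_sub_right, inner_neg_left, inner_neg_right, real_inner_smul_right,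
    real_inner_comm] at hsum ⊢
  linear_combination hsum

end SilverProx

/-! ### The trace term and the theorem -/

namespace SilverProx

/-- `Tr (V S Vᵀ)` is the bilinear form of `S` evaluated at the Gram matrix of the columns of `V`. -/
theorem trace_VMat_slack {d : ℕ} (k : ℕ) (x s : Option ℕ → EuclideanSpace ℝ (Fin d)) :
    Matrix.trace (VMat (k + 1) x s * slack (k + 1) * (VMat (k + 1) x s).transpose)
      = 1 / Real.sqrt 2 * inner ℝ (x (some 0) - x none) (x (some 0) - x none)
        + 2 * (inner ℝ (x (some 0) - x none) (s none)
          - inner ℝ (x (some 0) - x none) (s (some 1)))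
        + ∑ i ∈ Finset.range (horizon (k + 1)), ∑ j ∈ Finset.range (horizon (k + 1)),
            LBar (k + 1) (i + 1) (j + 1) * inner ℝ (s (some (i + 1))) (s (some (j + 1)))
        - 2 * ∑ i ∈ Finset.range (horizon (k + 1)),
            cSeq (k + 1) (i + 1) * inner ℝ (s (some (i + 1))) (s none)
        + 2 * (rho ^ (k + 1) - 1) * inner ℝ (s none) (s none) := by
  let v : ℕ → EuclideanSpace ℝ (Fin d) := fun j =>
    if j = 0 then x (some 0) - x none else if j ≤ horizon (k + 1) then s (some j) else s none
  have hV (a : Fin d) (j : Fin (horizon (k + 1) + 2)) : VMat (k + 1) x s a j = v j a := by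
    simp only [VMat, Matrix.of_apply, v]
    split_ifs <;> rfl
  have hv₀ : v 0 = x (some 0) - x none := if_pos rfl
  have hv {j : ℕ} (hj : j < horizon (k + 1)) : v (j + 1) = s (some (j + 1)) := by
    simp only [v]
    rw [if_neg (by omega), if_pos (by omega)]
  have hvn : v (horizon (k + 1) + 1) = s none := by
    simp only [v]
    rw [if_neg (by omega), if_neg (by omega)]
  have htr : Matrix.trace (VMat (k + 1) x s * slack (k + 1) * (VMat (k + 1) x s).transpose)
      = ∑ a, ∑ b, slack (k + 1) a b * inner ℝ (v a) (v b) := by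
    simp only [Matrix.trace, Matrix.diag_apply, Matrix.mul_apply, Matrix.transpose_apply, hV,
      PiLp.inner_apply, Finset.sum_mul, Finset.mul_sum]
    refine Finset.sum_comm.trans ((Finset.sum_congr rfl fun b _ => Finset.sum_comm).trans
      (Finset.sum_comm.trans ?_))
    exact Finset.sum_congr rfl fun a _ => Finset.sum_congr rfl fun b _ =>
      Finset.sum_congr rfl fun i _ => by
        simp only [RCLike.inner_apply, conj_trivial]; ring
  have hL : ∑ i ∈ Finset.range (horizon (k + 1)), ∑ j ∈ Finset.range (horizon (k + 1)),
        LBar (k + 1) (i + 1) (j + 1) * inner ℝ (v (i + 1)) (v (j + 1))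
      = ∑ i ∈ Finset.range (horizon (k + 1)), ∑ j ∈ Finset.range (horizon (k + 1)),
        LBar (k + 1) (i + 1) (j + 1) * inner ℝ (s (some (i + 1))) (s (some (j + 1))) :=
    Finset.sum_congr rfl fun i hi => Finset.sum_congr rfl fun j hj => by
      rw [hv (Finset.mem_range.1 hi), hv (Finset.mem_range.1 hj)]
  have hc : ∑ i ∈ Finset.range (horizon (k + 1)),
        cSeq (k + 1) (i + 1) * inner ℝ (v (i + 1)) (s none)
      = ∑ i ∈ Finset.range (horizon (k + 1)),
        cSeq (k + 1) (i + 1) * inner ℝ (s (some (i + 1))) (s none) :=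
    Finset.sum_congr rfl fun i hi => by rw [hv (Finset.mem_range.1 hi)]
  have hv₁ : v 1 = s (some 1) := hv (horizon_succ_pos k)
  rw [htr, sum_slack_mul k (fun i j => inner ℝ (v i) (v j)) fun i j => real_inner_comm _ _, hv₀,
    hvn, hv₁, hL, hc]

end SilverProx

theorem theorem2 (k : ℕ) (hk : 1 ≤ k) :
    -- (i) nonnegativity of the off-diagonal multipliers
    ((∀ i ∈ SilverProx.idxF k, ∀ j ∈ Finset.range (SilverProx.horizon k + 1),
        i ≠ some j → 0 ≤ SilverProx.lam k i j) ∧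
      (∀ i ∈ SilverProx.idxH k, ∀ j ∈ Finset.Icc 1 (SilverProx.horizon k),
        i ≠ some j → 0 ≤ SilverProx.mu k i j)) ∧
    -- (ii) positive semidefiniteness of the slack matrix
    (SilverProx.slack k).PosSemidef ∧
    -- (iii) the multi-step descent identity along proximal gradient descent
    (∀ (d : ℕ) (f : EuclideanSpace ℝ (Fin d) → ℝ) (h : EuclideanSpace ℝ (Fin d) → EReal)
        (x s : Option ℕ → EuclideanSpace ℝ (Fin d)),
      ConvexOn ℝ Set.univ f → SilverProx.OneSmooth f → SilverProx.ProperConvex h →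
      SilverProx.IsSilverProxGD f h (SilverProx.horizon k) x →
      SilverProx.IsMinimizer f h (x none) →
      -- the vectors `s` are those determined by the update and by the optimality condition
      (∀ t < SilverProx.horizon k, x (some (t + 1)) = x (some t)
        - SilverProx.silverStep t • (gradient f (x (some t)) + s (some (t + 1)))) →
      gradient f (x none) + s none = 0 →
      (∀ i ∈ SilverProx.idxH k, SilverProx.IsSubgradient h (x i) (s i)) ∧
      (∑ i ∈ SilverProx.idxF k, ∑ j ∈ Finset.range (SilverProx.horizon k + 1),
          SilverProx.lam k i j * SilverProx.Qf f x i (some j))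
        + (∑ i ∈ SilverProx.idxH k, ∑ j ∈ Finset.Icc 1 (SilverProx.horizon k),
          SilverProx.mu k i j * SilverProx.Qh h x s i (some j))
        = (2 * SilverProx.rho ^ k - 1)
            * (SilverProx.Fval f h x none - SilverProx.Fval f h x (some (SilverProx.horizon k)))
          + SilverProx.rho / (2 * Real.sqrt 2) * ‖x (some 0) - x none‖ ^ 2
          - 1 / 2 * (‖SilverProx.uVec k f x s‖ ^ 2
            + Matrix.trace (SilverProx.VMat k x s * SilverProx.slack k
                * (SilverProx.VMat k x s).transpose))) := by
  obtain ⟨k, rfl⟩ : ∃ m, k = m + 1 := ⟨k - 1, by omega⟩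
  refine ⟨⟨?_, ?_⟩, SilverProx.slack_posSemidef k, ?_⟩
  · rintro (_ | i) - j - -
    · exact SilverProx.lamStar_nonneg _ _
    · exact SilverProx.lamBar_nonneg _ _ _
  · rintro i hi j hj hij
    obtain ⟨j, rfl⟩ : ∃ m, j = m + 1 := ⟨j - 1, by have := (Finset.mem_Icc.1 hj).1; omega⟩
    have hj' : j < SilverProx.horizon (k + 1) := (Finset.mem_Icc.1 hj).2
    rcases i with _ | i
    · have h₁ := (SilverProx.silverStep_pos j).le.trans (SilverProx.silverStep_le_cSeq k hj')
      exact add_nonneg h₁ (by positivity)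
    · rw [SilverProx.idxH, Finset.some_mem_insertNone, Finset.mem_Icc] at hi
      obtain ⟨i, rfl⟩ : ∃ m, i = m + 1 := ⟨i - 1, by omega⟩
      exact SilverProx.muBar_nonneg k hi.2 hj' fun e => hij (by rw [e])
  · intro d f h x s _ hf hh hprox hmin hx hs
    refine ⟨?_, ?_⟩
    · rintro (_ | i) hi
      · exact SilverProx.isSubgradient_of_isMinimizer hf.1 hh hmin hs
      · rw [SilverProx.idxH, Finset.some_mem_insertNone, Finset.mem_Icc] at hi
        obtain ⟨i, rfl⟩ : ∃ m, i = m + 1 := ⟨i - 1, by omega⟩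
        refine SilverProx.isSubgradient_of_isProx hh (SilverProx.silverStep_pos i)
          (hprox i hi.2) ?_
        rw [hx i hi.2, smul_add, sub_add_eq_sub_sub]
    · rw [SilverProx.trace_VMat_slack]
      exact SilverProx.descent_identity k (fun i => f (x i)) (fun i => (h (x i)).toReal) x
        (fun i => gradient f (x i)) s hx hs
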